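/- Let $\rho$ be a measure on $\mathbb{R}$, $h\ge 0$ a measurable function, $\Theta=\{\theta\in\mathbb{R}:\int h(x)e^{x\theta}\rho(dx)<\infty\}$, $A(\theta)=\log\int h(x)e^{x\theta}\rho(dx)$, and consider the exponential family of laws $P_\theta(dx)=h(x)e^{x\theta-A(\theta)}\rho(dx)$, $\theta\in\Theta$. Assume that the family is steep, i.e. that no $P_\theta$ with $\theta\in\Theta\setminus\operatorname{int}\Theta$ has a finite mean (for example, $\Theta$ is open). Let $I$ be the set of finite means of members of the family, and for $z,w\in I$ let $D(z,w)$ be the Kullback–Leibler divergence from the member with mean $z$ to the member with mean $w$, extended to $\bar I\times\bar I$ by limits (as a $\liminf$, with values in $[0,\infty]$). Consider a two-armed bandit in which the successive rewards of arm $k\in\{1,2\}$ are i.i.d. from the member of the family with mean $\mu_k\in I$, the two arms being independent, and $\mu_1>\mu_2$. KL-UCB plays each arm once in the first two rounds and, for $t\ge 2$, plays in round $t+1$ an arm $k$ that maximizes $$\sup\{w\in\bar I: D(\hat\mu_k(t),w)\le \log(t)/N_k(t)\},$$ where $N_k(t)$ is the number of plays of arm $k$ in rounds $1,\dots,t$ and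 $\hat\mu_k(t)$ is the average of the rewards received from them; ties are broken in an arbitrary way. Then for every $\gamma\in(0,1)$, $$\lim_{T\to\infty}\frac{\log \mathbb{P}(N_2(T)>x)}{\log x}=-\inf_{z\in I,\;z<\mu_2}\frac{D(z,\mu_1)}{D(z,\mu_2)}$$ uniformly for $x\in[\log^{1+\gamma}(T),(1-\gamma)T]$, where the probabilities are positive for all sufficiently large $T$ and all such $x$. Moreover, if the condition (A2), that $\inf\Theta=-\infty$ and $\lim_{\theta\to-\infty}(\theta A'(\theta)-A(\theta))=\infty$, fails, then the right-hand side is strictly less than $-1$, i.e. the tail is strictly lighter than a (truncated) Cauchy tail. Condition (A2) does fail whenever the laws of the family assign positive mass to the left endpoint of their support, for example for Bernoulli arms. -/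

import Mathlib

open MeasureTheory ProbabilityTheory Filter Topology
open scoped NNReal ENNReal

noncomputable section

namespace ExpFamily

/-! The natural one-parameter exponential family on the real line with dominating measure `ρ`
and carrier `h`, that is, with densities `h x * exp (x * θ - A θ)` with respect to `ρ`. -/

/-- The natural parameter set: all `θ` for which `∫ h(x) exp(x θ) ρ(dx)` is finite. -/
def naturalParams (ρ : Measure ℝ) (h : ℝ → ℝ≥0) : Set ℝ :=
  {θ | Integrable (fun x => (h x : ℝ) * Real.exp (x * θ)) ρ}

/-- The log-partition function `A θ = log ∫ h(x) exp(x θ) ρ(dx)`. -/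
def logPartition (ρ : Measure ℝ) (h : ℝ → ℝ≥0) (θ : ℝ) : ℝ :=
  Real.log (∫ x, (h x : ℝ) * Real.exp (x * θ) ∂ρ)

/-- The member of the family with natural parameter `θ`. -/
def law (ρ : Measure ℝ) (h : ℝ → ℝ≥0) (θ : ℝ) : Measure ℝ :=
  ρ.withDensity (fun x => ENNReal.ofReal ((h x : ℝ) * Real.exp (x * θ - logPartition ρ h θ)))

/-- The mean of the member with natural parameter `θ`. -/
def mean (ρ : Measure ℝ) (h : ℝ → ℝ≥0) (θ : ℝ) : ℝ := ∫ x, x ∂(law ρ h θ)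

/-- The natural parameters of the members that have a finite mean. -/
def finiteMeanParams (ρ : Measure ℝ) (h : ℝ → ℝ≥0) : Set ℝ :=
  {θ | θ ∈ naturalParams ρ h ∧ Integrable (fun x : ℝ => x) (law ρ h θ)}

/-- The set `I` of all (finite) means of members of the family. -/
def meanSet (ρ : Measure ℝ) (h : ℝ → ℝ≥0) : Set ℝ := mean ρ h '' finiteMeanParams ρ h

/-- Steepness: a member whose parameter is an end point of the natural parameter set has no finite
mean. In particular every family whose natural parameter set is open (a regular family) is steep.
If steepness fails, the support reaches beyond the closure of the set of means, so that empirical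
means leave the set on which the divergence (and hence KL-UCB) is defined. -/
def IsSteep (ρ : Measure ℝ) (h : ℝ → ℝ≥0) : Prop :=
  finiteMeanParams ρ h ⊆ interior (naturalParams ρ h)

/-- The member of the family with mean `z`, for `z` in `meanSet ρ h`. -/
def lawOfMean (ρ : Measure ℝ) (h : ℝ → ℝ≥0) (z : ℝ) : Measure ℝ :=
  law ρ h (Function.invFunOn (mean ρ h) (finiteMeanParams ρ h) z)

/-- `D(z, w)`: the Kullback-Leibler divergence from the member with mean `z` to the member with
mean `w`. -/
def divergence (ρ : Measure ℝ) (h : ℝ → ℝ≥0) (z w : ℝ) : ℝ≥0∞ :=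
  InformationTheory.klDiv (lawOfMean ρ h z) (lawOfMean ρ h w)

/-- The extension of `D` to the closure of the set of means, by limits (a sample mean can be an
end point of the interval of means, for instance for Bernoulli rewards). -/
def divergenceExt (ρ : Measure ℝ) (h : ℝ → ℝ≥0) (x w : ℝ) : ℝ≥0∞ :=
  Filter.liminf (fun p : ℝ × ℝ => divergence ρ h p.1 p.2)
    (𝓝[meanSet ρ h ×ˢ meanSet ρ h] (x, w))

/-- The KL-UCB index at time `t` of an arm that has been played `n` times with sample mean `x`:
the supremum of all `w` in the closure of the set of means with `D(x, w) ≤ log t / n`. -/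
def klucbIndex (ρ : Measure ℝ) (h : ℝ → ℝ≥0) (x : ℝ) (n t : ℕ) : EReal :=
  sSup ((fun w : ℝ => (w : EReal)) '' {w | w ∈ closure (meanSet ρ h) ∧
    divergenceExt ρ h x w ≤ ENNReal.ofReal (Real.log (t : ℝ) / (n : ℝ))})

/-- `N_k(t)`: the number of plays of arm `k` in the rounds `1, …, t` if arm `a s` is played in
round `s`. -/
def plays (a : ℕ → Fin 2) (k : Fin 2) (t : ℕ) : ℕ :=
  ((Finset.Icc 1 t).filter (fun s => a s = k)).card

/-- The average of the first `n` rewards of an arm with reward sequence `r`. -/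
def sampleMean (r : ℕ → ℝ) (n : ℕ) : ℝ := (∑ i ∈ Finset.range n, r i) / (n : ℝ)

/-- The arm sequence `a 1, a 2, …` is produced by KL-UCB when `r k i` is the reward of the
`(i + 1)`-st play of arm `k`: each arm is played once in the first two rounds, and an arm of
maximal index at time `t` is played in round `t + 1` for `t ≥ 2` (ties broken in any way). -/
structure IsKLUCBRun (ρ : Measure ℝ) (h : ℝ → ℝ≥0) (r : Fin 2 → ℕ → ℝ) (a : ℕ → Fin 2) :
    Prop where
  init : ∀ k, plays a k 2 = 1
  greedy : ∀ t, 2 ≤ t → ∀ k,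
    klucbIndex ρ h (sampleMean (r k) (plays a k t)) (plays a k t) t ≤
      klucbIndex ρ h (sampleMean (r (a (t + 1))) (plays a (a (t + 1)) t))
        (plays a (a (t + 1)) t) t

/-- `inf D(z, μ₁) / D(z, μ₂)` over all means `z < μ₂` of the family. -/
def tailExponent (ρ : Measure ℝ) (h : ℝ → ℝ≥0) (μ₁ μ₂ : ℝ) : ℝ :=
  ⨅ z : {z : ℝ // z ∈ meanSet ρ h ∧ z < μ₂},
    (divergence ρ h z μ₁).toReal / (divergence ρ h z μ₂).toReal

/-- The condition `inf Θ = -∞` and `θ A'(θ) - A(θ) → ∞` as `θ → -∞`. -/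
def LeftTailCondition (ρ : Measure ℝ) (h : ℝ → ℝ≥0) : Prop :=
  ¬ BddBelow (naturalParams ρ h) ∧
    Tendsto (fun θ => θ * deriv (logPartition ρ h) θ - logPartition ρ h θ) atBot atTop

end ExpFamily

end

/-! The laws of the family are exponential tilts of the measure h dρ. If A is its cumulant
generating function, the divergence from parameter θ to parameter φ is the Bregman divergence D(θ,
φ) = A(φ) - A(θ) - (φ - θ) A'(θ) (`klDiv_tilted`). Let θ₂ < θ₁ be the parameters of the two arms and
κ the infimum of D(θ, θ₁) / D(θ, θ₂) over θ < θ₂. The tail is governed by one scenario: a short run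
of bad rewards pushes the index of the optimal arm below μ₂, and the slow growth of log t keeps it
there.

Lower bound (`exists_le_measure_plays`): for a nearly optimal θ, let the first n ≈ log t / D(θ, θ₂)
rewards of the optimal arm average about A'(θ). A change of measure prices this at exp(-n D(θ, θ₁)),
which is t to the power -κ up to an arbitrarily small loss in the exponent. With probability bounded
below, independently, no sample mean of the other arm drops below a level slightly under μ₂. The
optimal arm is then not played again before time t, so the other one gets t - O(log t) plays. The
horizon t = ⌊x / (1 - γ)⌋ ≤ T makes this exceed x.

Upper bound (`exists_measure_plays_le`): more than M = ⌊x⌋ plays of the suboptimal arm require that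
it is chosen when it has exactly M plays. As log T is small compared with M, its index is then
barely above μ₂, outside an event of probability exponentially small in M. So some sample mean of
the optimal arm, after n plays, lies at divergence more than log M / n from a level χ just above θ₂.
Chernoff's bound gives about M to the power -κ for each n; a small share of the exponent is kept
back to make the sum over n geometric.

For κ > 1, the three-point identity writes D(θ, θ₁) - D(θ, θ₂) as D(θ₂, θ₁) + (θ₁ - θ₂)(A'(θ₂) -
A'(θ)). If (A2) fails, D(θ, θ₂) is at most a constant multiple of this. Steepness enters through
`ae_mem_closure_meanSet`: sample means never leave the closure of the set of means, where the index
is meaningful. -/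

/-! ### One-parameter exponential tilting of a measure on the real line -/

namespace ExpTilt

open Set

/-- The open set of interior parameters of the cumulant generating function of `m`. -/
abbrev params (m : Measure ℝ) : Set ℝ := interior (integrableExpSet id m)

/-- The Bregman divergence of the cumulant generating function. -/
noncomputable def breg (m : Measure ℝ) (θ φ : ℝ) : ℝ :=
  cgf id m φ - cgf id m θ - (φ - θ) * deriv (cgf id m) θ

variable {m : Measure ℝ} {θ φ ψ : ℝ}

lemma isOpen_params : IsOpen (params m) := isOpen_interior

lemma convex_params : Convex ℝ (params m) := convex_integrableExpSet.interior

lemma ordConnected_params : OrdConnected (params m) := convex_params.ordConnected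

lemma integrable_exp (hθ : θ ∈ params m) : Integrable (fun x => Real.exp (θ * x)) m :=
  interior_subset (s := integrableExpSet id m) hθ

lemma hasDerivAt_cgf (hθ : θ ∈ params m) :
    HasDerivAt (cgf id m) (deriv (cgf id m) θ) θ :=
  (analyticAt_cgf hθ).differentiableAt.hasDerivAt

lemma continuousOn_cgf : ContinuousOn (cgf id m) (params m) :=
  fun _ hθ => (hasDerivAt_cgf hθ).continuousAt.continuousWithinAt

lemma differentiableAt_deriv_cgf (hθ : θ ∈ params m) :
    DifferentiableAt ℝ (deriv (cgf id m)) θ :=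
  (analyticAt_cgf hθ).deriv.differentiableAt

lemma continuousAt_deriv_cgf (hθ : θ ∈ params m) : ContinuousAt (deriv (cgf id m)) θ :=
  (differentiableAt_deriv_cgf hθ).continuousAt

lemma continuousOn_deriv_cgf : ContinuousOn (deriv (cgf id m)) (params m) :=
  fun _ hθ => (continuousAt_deriv_cgf hθ).continuousWithinAt

lemma isProbabilityMeasure_tilted_id (hm : m ≠ 0) (hθ : θ ∈ params m) :
    IsProbabilityMeasure (m.tilted (fun x => θ * x)) :=
  have : NeZero m := ⟨hm⟩
  isProbabilityMeasure_tilted (integrable_exp hθ)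

lemma memLp_id_tilted (hθ : θ ∈ params m) :
    MemLp (fun x : ℝ => x) 2 (m.tilted (fun x => θ * x)) := by
  exact_mod_cast memLp_tilted_mul (X := id) hθ 2

lemma integrable_id_tilted (hm : m ≠ 0) (hθ : θ ∈ params m) :
    Integrable (fun x : ℝ => x) (m.tilted (fun x => θ * x)) :=
  have := isProbabilityMeasure_tilted_id hm hθ
  (memLp_id_tilted hθ).integrable (by norm_num)

lemma integral_id_tilted (hθ : θ ∈ params m) :
    ∫ x, x ∂(m.tilted (fun x => θ * x)) = deriv (cgf id m) θ :=
  integral_tilted_mul_self (X := id) hθ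

lemma tilted_tilted_id (hθ : θ ∈ params m) (φ : ℝ) :
    (m.tilted (fun x => θ * x)).tilted (fun x => (φ - θ) * x) = m.tilted (fun x => φ * x) := by
  rw [tilted_tilted (integrable_exp hθ)]
  congr 1
  ext x
  simp only [Pi.add_apply]
  ring

/-- If the mean is not constant over the family, the variances are positive. -/
lemma deriv_deriv_cgf_pos (hm : m ≠ 0) {a b : ℝ} (ha : a ∈ params m) (hb : b ∈ params m)
    (hab : deriv (cgf id m) a ≠ deriv (cgf id m) b) (hθ : θ ∈ params m) :
    0 < deriv (deriv (cgf id m)) θ := by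
  have := isProbabilityMeasure_tilted_id hm hθ
  have hvar : Var[id; m.tilted (fun x => θ * x)] = deriv (deriv (cgf id m)) θ := by
    have := variance_tilted_mul (X := id) hθ
    rw [iteratedDeriv_succ, iteratedDeriv_one] at this
    exact this
  rw [← hvar]
  refine lt_of_le_of_ne (variance_nonneg _ _) fun h0 => hab ?_
  have hev : evariance id (m.tilted (fun x => θ * x)) = 0 := by
    have := (memLp_id_tilted hθ).ofReal_variance_eq
    refine this.symm.trans ?_
    exact ENNReal.ofReal_eq_zero.2 (le_of_eq h0.symm)
  have hae := (evariance_eq_zero_iff aemeasurable_id).1 hev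
  -- Zero variance at `θ` makes the identity a.e. constant; every other tilt is absolutely
  -- continuous with respect to this one, so it has the same mean.
  have hae' : ∀ c ∈ params m, deriv (cgf id m) c = (m.tilted (fun x => θ * x))[id] := by
    intro c hc
    have := isProbabilityMeasure_tilted_id hm hc
    rw [← integral_id_tilted hc, ← tilted_tilted_id hθ c]
    have h2 : (fun x : ℝ => x) =ᵐ[(m.tilted (fun x => θ * x)).tilted (fun x => (c - θ) * x)]
        fun _ => ∫ x, id x ∂m.tilted (fun x => θ * x) :=
      (tilted_absolutelyContinuous (m.tilted (fun x => θ * x))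
        (fun x => (c - θ) * x)).ae_le hae
    rw [← tilted_tilted_id hθ c] at this
    rw [integral_congr_ae h2]
    simp
  rw [hae' a ha, hae' b hb]

lemma strictMonoOn_deriv_cgf (hm : m ≠ 0) {a b : ℝ} (ha : a ∈ params m) (hb : b ∈ params m)
    (hab : deriv (cgf id m) a ≠ deriv (cgf id m) b) :
    StrictMonoOn (deriv (cgf id m)) (params m) := by
  refine strictMonoOn_of_deriv_pos convex_params continuousOn_deriv_cgf fun x hx => ?_
  rw [interior_interior] at hx
  exact deriv_deriv_cgf_pos hm ha hb hab hx

/-- The three-point identity of a Bregman divergence. -/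
lemma breg_eq_add (m : Measure ℝ) (θ ψ φ : ℝ) :
    breg m θ φ = breg m θ ψ + breg m ψ φ
      + (φ - ψ) * (deriv (cgf id m) ψ - deriv (cgf id m) θ) := by
  unfold breg; ring

lemma breg_self (m : Measure ℝ) (θ : ℝ) : breg m θ θ = 0 := by
  unfold breg; ring

lemma continuousAt_breg_right (hφ : φ ∈ params m) : ContinuousAt (fun y => breg m θ y) φ := by
  unfold breg
  have := (hasDerivAt_cgf hφ).continuousAt
  fun_prop

lemma continuousAt_breg (hθ : θ ∈ params m) (hφ : φ ∈ params m) :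
    ContinuousAt (fun p : ℝ × ℝ => breg m p.1 p.2) (θ, φ) := by
  unfold breg
  have h1 : ContinuousAt (fun p : ℝ × ℝ => cgf id m p.2) (θ, φ) :=
    ContinuousAt.comp (x := (θ, φ)) (g := cgf id m) (hasDerivAt_cgf hφ).continuousAt
      continuousAt_snd
  have h2 : ContinuousAt (fun p : ℝ × ℝ => cgf id m p.1) (θ, φ) :=
    ContinuousAt.comp (x := (θ, φ)) (g := cgf id m) (hasDerivAt_cgf hθ).continuousAt
      continuousAt_fst
  have h3 : ContinuousAt (fun p : ℝ × ℝ => deriv (cgf id m) p.1) (θ, φ) :=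
    ContinuousAt.comp (x := (θ, φ)) (g := deriv (cgf id m)) (continuousAt_deriv_cgf hθ)
      continuousAt_fst
  fun_prop

section Mono

variable (hM : StrictMonoOn (deriv (cgf id m)) (params m))
include hM

/-- By the mean value theorem the slope of the cumulant generating function between the two
parameters is its derivative at an intermediate point, which differs strictly from the derivative at
`θ`. -/
lemma breg_pos (hθ : θ ∈ params m) (hφ : φ ∈ params m) (h : θ ≠ φ) : 0 < breg m θ φ := by
  have key : ∀ a b : ℝ, a ∈ params m → b ∈ params m → a < b →
      ∃ c ∈ Ioo a b, c ∈ params m ∧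
        cgf id m b - cgf id m a = (b - a) * deriv (cgf id m) c := by
    intro a b ha hb hab
    have hsub : Icc a b ⊆ params m := ordConnected_params.out ha hb
    obtain ⟨c, hc, hce⟩ := exists_deriv_eq_slope (cgf id m) hab
      (continuousOn_cgf.mono hsub)
      (fun x hx => (hasDerivAt_cgf (hsub (Ioo_subset_Icc_self hx))).differentiableAt
        |>.differentiableWithinAt)
    refine ⟨c, hc, hsub (Ioo_subset_Icc_self hc), ?_⟩
    rw [hce]
    have : b - a ≠ 0 := by linarith
    field_simp
  unfold breg
  rcases lt_or_gt_of_ne h with h | h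
  · obtain ⟨c, hc, hcJ, hce⟩ := key θ φ hθ hφ h
    have := hM hθ hcJ hc.1
    rw [hce]
    nlinarith
  · obtain ⟨c, hc, hcJ, hce⟩ := key φ θ hφ hθ h
    have := hM hcJ hθ hc.2
    nlinarith

lemma breg_nonneg (hθ : θ ∈ params m) (hφ : φ ∈ params m) : 0 ≤ breg m θ φ := by
  rcases eq_or_ne θ φ with rfl | h
  · rw [breg_self]
  · exact (breg_pos hM hθ hφ h).le

/-- For ordered parameters all terms of the three-point identity are nonnegative, so any of them may
be dropped. The same argument gives `breg_mono_right`. -/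
lemma breg_anti_left (hψ : ψ ∈ params m) (hθ : θ ∈ params m) (hψθ : ψ ≤ θ)
    (hθφ : θ ≤ φ) : breg m θ φ ≤ breg m ψ φ := by
  have h1 := breg_nonneg hM hψ hθ
  have h2 := hM.monotoneOn hψ hθ hψθ
  rw [breg_eq_add m ψ θ φ]
  nlinarith

lemma breg_mono_right (hθ : θ ∈ params m) (hφ : φ ∈ params m) (hψ : ψ ∈ params m)
    (hθφ : θ ≤ φ) (hφψ : φ ≤ ψ) : breg m θ φ ≤ breg m θ ψ := by
  have h1 := breg_nonneg hM hφ hψ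
  have h2 := hM.monotoneOn hθ hφ hθφ
  rw [breg_eq_add m θ φ ψ]
  nlinarith

end Mono

/-- The Kullback-Leibler divergence between two tilted measures is the Bregman divergence. -/
lemma klDiv_tilted (hm : m ≠ 0) (hθ : θ ∈ params m) (hφ : φ ∈ params m) :
    InformationTheory.klDiv (m.tilted (fun x => θ * x)) (m.tilted (fun x => φ * x))
      = ENNReal.ofReal (breg m θ φ) := by
  have : NeZero m := ⟨hm⟩
  have := isProbabilityMeasure_tilted_id hm hθ
  have := isProbabilityMeasure_tilted_id hm hφ
  set μ := m.tilted (fun x => θ * x) with hμ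
  have hexp : Integrable (fun x => Real.exp ((φ - θ) * x)) μ := by
    rw [hμ, integrable_tilted_iff (integrable_exp hθ)]
    refine (integrable_exp hφ).congr (ae_of_all _ fun x => ?_)
    simp only [smul_eq_mul, ← Real.exp_add]
    ring_nf
  have hlog : Real.log (∫ x, Real.exp ((φ - θ) * x) ∂μ) = cgf id m φ - cgf id m θ := by
    rw [hμ, integral_exp_tilted]
    have e : (fun x => θ * x) + (fun x => (φ - θ) * x) = fun x => φ * x := by
      ext x; simp only [Pi.add_apply]; ring
    rw [Real.log_div]
    · simp only [e, cgf, mgf, id]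
    · simp only [e]; exact (mgf_pos' hm (integrable_exp hφ)).ne'
    · exact (mgf_pos' hm (integrable_exp hθ)).ne'
  have hid : Integrable (fun x => (φ - θ) * x) μ := (integrable_id_tilted hm hθ).const_mul _
  have hllr : Integrable (llr μ μ) μ := (integrable_zero _ _ _).congr (llr_self μ).symm
  -- The second law is a tilt of the first, so the log-likelihood ratio reduces to that of `μ`
  -- against itself, which vanishes, plus a linear term and a log-normaliser.
  have hν : m.tilted (fun x => φ * x) = μ.tilted (fun x => (φ - θ) * x) :=
    (tilted_tilted_id hθ φ).symm
  have hac : μ ≪ μ.tilted (fun x => (φ - θ) * x) := absolutelyContinuous_tilted hexp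
  have : IsProbabilityMeasure (μ.tilted (fun x => (φ - θ) * x)) := hν ▸ inferInstance
  rw [hν]
  have hint := integrable_llr_tilted_right (Measure.AbsolutelyContinuous.refl μ) hid hllr hexp
  rw [← ENNReal.ofReal_toReal (InformationTheory.klDiv_ne_top hac hint),
    InformationTheory.toReal_klDiv_of_measure_eq hac (by simp),
    integral_llr_tilted_right (Measure.AbsolutelyContinuous.refl μ) hid hexp hllr, hlog,
    integral_congr_ae (llr_self μ), integral_const_mul, hμ, integral_id_tilted hθ]
  unfold breg
  congr 1
  simp
  ring

end ExpTilt

/-! ### Steepness confines the support -/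

namespace ExpTilt

open Set

/-- If `J` is exactly the set of parameters at which the tilted mean of `Y` is finite, `J` is open,
and all these means are nonpositive, then `Y` is nonpositive almost everywhere. -/
lemma ae_nonpos_of_steep {Ω : Type*} [MeasurableSpace Ω] {μ : Measure Ω} {Y : Ω → ℝ}
    (hY : Measurable Y) {J : Set ℝ} (hJ : IsOpen J) {θ₀ : ℝ} (hθ₀ : θ₀ ∈ J)
    (hint : ∀ θ ∈ J, Integrable (fun ω => Real.exp (θ * Y ω)) μ)
    (hintY : ∀ θ ∈ J, Integrable (fun ω => Y ω * Real.exp (θ * Y ω)) μ)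
    (hneg : ∀ θ ∈ J, ∫ ω, Y ω * Real.exp (θ * Y ω) ∂μ ≤ 0)
    (hsteep : ∀ θ, Integrable (fun ω => Real.exp (θ * Y ω)) μ →
      Integrable (fun ω => Y ω * Real.exp (θ * Y ω)) μ → θ ∈ J) :
    ∀ᵐ ω ∂μ, Y ω ≤ 0 := by
  -- the negative part
  have hminus : Integrable (fun ω => max (-Y ω) 0 * Real.exp (θ₀ * Y ω)) μ := by
    refine (hintY θ₀ hθ₀).mono (by fun_prop) (ae_of_all _ fun ω => ?_)
    rw [norm_mul, norm_mul]
    gcongr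
    rw [Real.norm_eq_abs, Real.norm_eq_abs, abs_of_nonneg (le_max_right _ _)]
    exact max_le (neg_le_abs _) (abs_nonneg _)
  set C := ∫ ω, max (-Y ω) 0 * Real.exp (θ₀ * Y ω) ∂μ
  have hmle : ∀ θ : ℝ, θ₀ ≤ θ → ∀ ω,
      max (-Y ω) 0 * Real.exp (θ * Y ω) ≤ max (-Y ω) 0 * Real.exp (θ₀ * Y ω) := by
    intro θ hθ ω
    rcases le_total (Y ω) 0 with h | h
    · gcongr ?_ * Real.exp ?_
      nlinarith
    · rw [max_eq_right (by linarith)]; simp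
  -- A nonpositive tilted mean bounds the positive part by the negative part, and the latter
  -- decreases in `θ`; hence the bound `C` is uniform over `θ ≥ θ₀`.
  have hplus : ∀ θ ∈ J, θ₀ ≤ θ →
      ∫⁻ ω, ENNReal.ofReal (max (Y ω) 0 * Real.exp (θ * Y ω)) ∂μ ≤ ENNReal.ofReal C := by
    intro θ hθ hle
    have hle2 : ∀ ω, max (Y ω) 0 * Real.exp (θ * Y ω)
        ≤ Y ω * Real.exp (θ * Y ω) + max (-Y ω) 0 * Real.exp (θ₀ * Y ω) := by
      intro ω
      have h1 := hmle θ hle ω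
      have h2 : max (Y ω) 0 = Y ω + max (-Y ω) 0 := by
        rcases le_total (Y ω) 0 with h | h
        · rw [max_eq_right h, max_eq_left (by linarith)]; ring
        · rw [max_eq_left h, max_eq_right (by linarith)]; ring
      rw [h2, add_mul]
      linarith
    calc ∫⁻ ω, ENNReal.ofReal (max (Y ω) 0 * Real.exp (θ * Y ω)) ∂μ
        ≤ ∫⁻ ω, ENNReal.ofReal
            (Y ω * Real.exp (θ * Y ω) + max (-Y ω) 0 * Real.exp (θ₀ * Y ω)) ∂μ :=
          lintegral_mono fun ω => ENNReal.ofReal_le_ofReal (hle2 ω)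
      _ = ENNReal.ofReal (∫ ω, (Y ω * Real.exp (θ * Y ω)
            + max (-Y ω) 0 * Real.exp (θ₀ * Y ω)) ∂μ) := by
          refine (ofReal_integral_eq_lintegral_ofReal ((hintY θ hθ).add hminus) ?_).symm
          exact ae_of_all _ fun ω => le_trans (by positivity) (hle2 ω)
      _ ≤ ENNReal.ofReal C := by
          apply ENNReal.ofReal_le_ofReal
          rw [integral_add (hintY θ hθ) hminus]
          linarith [hneg θ hθ]
  -- If `J` is bounded, Fatou carries the bound to its supremum, where the tilted mean is therefore
  -- finite; `hsteep` puts the supremum into the open set `J`, which is absurd.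
  by_cases hbdd : BddAbove J
  · exfalso
    have hne : J.Nonempty := ⟨θ₀, hθ₀⟩
    set s := sSup J with hs
    have hθs : θ₀ ≤ s := le_csSup hbdd hθ₀
    have hsJ : s ∉ J := by
      intro hsJ
      obtain ⟨ε, hε, hball⟩ := Metric.isOpen_iff.1 hJ s hsJ
      have : s + ε / 2 ∈ J := hball (by
        rw [Metric.mem_ball, Real.dist_eq, add_sub_cancel_left, abs_of_pos (by linarith)]
        linarith)
      linarith [le_csSup hbdd this]
    have hlt : θ₀ < s := lt_of_le_of_ne hθs fun h => hsJ (h ▸ hθ₀)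
    obtain ⟨u, -, hu, huJ⟩ := exists_seq_tendsto_sSup hne hbdd
    have hev : ∀ᶠ k in atTop, θ₀ ≤ u k := hu.eventually (eventually_ge_nhds hlt)
    have hfatou : ∫⁻ ω, ENNReal.ofReal (max (Y ω) 0 * Real.exp (s * Y ω)) ∂μ
        ≤ ENNReal.ofReal C := by
      have hlim : ∀ ω, liminf (fun k => ENNReal.ofReal (max (Y ω) 0 * Real.exp (u k * Y ω))) atTop
          = ENNReal.ofReal (max (Y ω) 0 * Real.exp (s * Y ω)) := by
        intro ω
        refine Tendsto.liminf_eq ?_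
        refine ENNReal.tendsto_ofReal ?_
        refine Tendsto.const_mul _ ?_
        exact (Real.continuous_exp.tendsto _).comp (hu.mul_const _)
      calc ∫⁻ ω, ENNReal.ofReal (max (Y ω) 0 * Real.exp (s * Y ω)) ∂μ
          = ∫⁻ ω, liminf (fun k => ENNReal.ofReal (max (Y ω) 0 * Real.exp (u k * Y ω))) atTop ∂μ :=
            lintegral_congr fun ω => (hlim ω).symm
        _ ≤ liminf (fun k => ∫⁻ ω, ENNReal.ofReal (max (Y ω) 0 * Real.exp (u k * Y ω)) ∂μ) atTop :=
            lintegral_liminf_le fun k => by fun_prop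
        _ ≤ ENNReal.ofReal C := by
            refine liminf_le_of_frequently_le' (Eventually.frequently ?_)
            filter_upwards [hev] with k hk using hplus _ (huJ k) hk
    have hp : Integrable (fun ω => max (Y ω) 0 * Real.exp (s * Y ω)) μ := by
      refine ⟨by fun_prop, ?_⟩
      rw [hasFiniteIntegral_iff_ofReal (ae_of_all _ fun ω => by positivity)]
      exact hfatou.trans_lt ENNReal.ofReal_lt_top
    refine hsJ (hsteep s ?_ ?_)
    · refine (hp.add ((hint θ₀ hθ₀).const_mul (Real.exp (s - θ₀)))).mono' (by fun_prop)
        (ae_of_all _ fun ω => ?_)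
      rw [Real.norm_eq_abs, Real.abs_exp, Pi.add_apply]
      rcases le_total 1 (Y ω) with h | h
      · have h1 : Real.exp (s * Y ω) ≤ max (Y ω) 0 * Real.exp (s * Y ω) :=
          le_mul_of_one_le_left (Real.exp_pos _).le (le_max_of_le_left h)
        have h2 : 0 ≤ Real.exp (s - θ₀) * Real.exp (θ₀ * Y ω) := by positivity
        linarith
      · have h1 : Real.exp (s * Y ω) ≤ Real.exp (s - θ₀) * Real.exp (θ₀ * Y ω) := by
          rw [← Real.exp_add]
          apply Real.exp_le_exp.2
          nlinarith
        have h2 : 0 ≤ max (Y ω) 0 * Real.exp (s * Y ω) := by positivity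
        linarith
    · refine (hp.add hminus).mono' (by fun_prop) (ae_of_all _ fun ω => ?_)
      rw [norm_mul, Real.norm_eq_abs, Real.norm_eq_abs, Real.abs_exp, Pi.add_apply]
      have h1 := hmle s hθs ω
      have h2 : |Y ω| = max (Y ω) 0 + max (-Y ω) 0 := by
        rcases le_total (Y ω) 0 with h | h
        · rw [max_eq_right h, max_eq_left (by linarith), abs_of_nonpos h]; ring
        · rw [max_eq_left h, max_eq_right (by linarith), abs_of_nonneg h]; ring
      rw [h2, add_mul]
      linarith
  -- If `J` is unbounded, the integrand blows up on `η ≤ Y` as `θ` grows, so by Markov's inequality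
  -- the uniform bound forces that set to be null.
  · have hzero : ∀ k : ℕ, μ {ω | 1 / ((k : ℝ) + 1) ≤ Y ω} = 0 := by
      intro k
      set η : ℝ := 1 / ((k : ℝ) + 1) with hη
      have hη0 : 0 < η := by positivity
      by_contra hp
      obtain ⟨n, hn⟩ := ENNReal.exists_nat_mul_gt hp (ENNReal.ofReal_ne_top (r := C))
      obtain ⟨θ, hθJ, hθ⟩ := not_bddAbove_iff.1 hbdd (max θ₀ (n / η ^ 2))
      have h1 : θ₀ ≤ θ := (le_max_left _ _).trans hθ.le
      have h2 : n / η ^ 2 ≤ θ := (le_max_right _ _).trans hθ.le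
      have h0 : 0 ≤ θ := le_trans (by positivity) h2
      have hnle : (n : ℝ) ≤ η * Real.exp (θ * η) := by
        have : θ * η ≤ Real.exp (θ * η) := by linarith [Real.add_one_le_exp (θ * η)]
        have h3 : (n : ℝ) ≤ θ * η ^ 2 := by
          rwa [div_le_iff₀ (by positivity)] at h2
        nlinarith
      have hmk := mul_meas_ge_le_lintegral (μ := μ)
        (f := fun ω => ENNReal.ofReal (max (Y ω) 0 * Real.exp (θ * Y ω))) (by fun_prop)
        (ENNReal.ofReal n)
      have hsub : {ω | η ≤ Y ω} ⊆
          {ω | ENNReal.ofReal n ≤ ENNReal.ofReal (max (Y ω) 0 * Real.exp (θ * Y ω))} := by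
        intro ω hω
        simp only [mem_ofPred_eq] at hω ⊢
        apply ENNReal.ofReal_le_ofReal
        refine hnle.trans ?_
        gcongr
        exact le_max_of_le_left hω
      have := (mul_le_mul_right (measure_mono (μ := μ) hsub) (ENNReal.ofReal n)).trans
        (hmk.trans (hplus θ hθJ h1))
      rw [ENNReal.ofReal_natCast] at this
      exact absurd hn (not_lt.2 this)
    rw [ae_iff]
    refine measure_mono_null (t := ⋃ k : ℕ, {ω | 1 / ((k : ℝ) + 1) ≤ Y ω}) ?_
      (measure_iUnion_null hzero)
    intro ω hω
    simp only [mem_ofPred_eq, not_le] at hω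
    obtain ⟨k, hk⟩ := exists_nat_one_div_lt hω
    exact mem_iUnion.2 ⟨k, hk.le⟩

end ExpTilt

/-! ### The family as tilts of its carrier -/

namespace ExpFamily

open Set ExpTilt

/-- The measure `h(x) ρ(dx)` generating the exponential family. -/
noncomputable def carrier (ρ : Measure ℝ) (h : ℝ → ℝ≥0) : Measure ℝ :=
  ρ.withDensity (fun x => (h x : ℝ≥0∞))

variable {ρ : Measure ℝ} {h : ℝ → ℝ≥0}

lemma naturalParams_eq (hh : Measurable h) :
    naturalParams ρ h = integrableExpSet id (carrier ρ h) := by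
  ext θ
  simp only [naturalParams, integrableExpSet, mem_ofPred_eq, carrier]
  rw [integrable_withDensity_iff_integrable_smul hh]
  simp only [NNReal.smul_def, smul_eq_mul, id, mul_comm θ]

lemma logPartition_eq (hh : Measurable h) : logPartition ρ h = cgf id (carrier ρ h) := by
  ext θ
  simp only [logPartition, cgf, mgf, carrier]
  rw [integral_withDensity_eq_integral_smul hh]
  simp only [NNReal.smul_def, smul_eq_mul, id, mul_comm θ]

lemma law_eq_withDensity (hh : Measurable h) (θ : ℝ) :
    law ρ h θ = (carrier ρ h).withDensity
      (fun x => ENNReal.ofReal (Real.exp (x * θ - logPartition ρ h θ))) := by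
  rw [law, carrier, ← withDensity_mul _ (by fun_prop) (by fun_prop)]
  congr 1
  ext x
  simp only [Pi.mul_apply]
  rw [ENNReal.ofReal_mul (by positivity), ENNReal.ofReal_coe_nnreal]

lemma carrier_ne_zero (hh : Measurable h) (hnt : (meanSet ρ h).Nontrivial) :
    carrier ρ h ≠ 0 := by
  intro h0
  obtain ⟨_, ⟨θ, -, rfl⟩, _, ⟨φ, -, rfl⟩, hne⟩ := hnt
  apply hne
  simp [mean, law_eq_withDensity hh, h0]

lemma law_eq_tilted (hh : Measurable h) (hm : carrier ρ h ≠ 0) {θ : ℝ}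
    (hθ : θ ∈ naturalParams ρ h) :
    law ρ h θ = (carrier ρ h).tilted (fun x => θ * x) := by
  rw [naturalParams_eq hh] at hθ
  have : NeZero (carrier ρ h) := ⟨hm⟩
  have hexp := exp_cgf (X := id) hθ
  simp only [mgf, id] at hexp
  rw [law_eq_withDensity hh, Measure.tilted, logPartition_eq hh, ← hexp]
  congr 1
  ext x
  rw [mul_comm x, Real.exp_sub]

lemma mem_finiteMeanParams_iff (hh : Measurable h) (hm : carrier ρ h ≠ 0) {θ : ℝ} :
    θ ∈ finiteMeanParams ρ h ↔ Integrable (fun x => Real.exp (θ * x)) (carrier ρ h) ∧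
      Integrable (fun x => x * Real.exp (θ * x)) (carrier ρ h) := by
  simp only [finiteMeanParams, mem_ofPred_eq]
  have key : θ ∈ naturalParams ρ h ↔ Integrable (fun x => Real.exp (θ * x)) (carrier ρ h) := by
    rw [naturalParams_eq hh]; rfl
  rw [← key]
  refine and_congr_right fun hθ => ?_
  rw [law_eq_tilted hh hm hθ, integrable_tilted_iff (key.1 hθ)]
  simp only [smul_eq_mul, mul_comm]

section Steep

variable (hh : Measurable h) (hsteep : IsSteep ρ h) (hm : carrier ρ h ≠ 0)
include hh hsteep hm

/-- Steepness is one inclusion; the other holds because interior parameters have finite moments. -/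
lemma finiteMeanParams_eq : finiteMeanParams ρ h = params (carrier ρ h) := by
  apply subset_antisymm
  · have := hsteep
    rwa [IsSteep, naturalParams_eq hh] at this
  · intro θ hθ
    refine (mem_finiteMeanParams_iff hh hm).2 ⟨integrable_exp hθ, ?_⟩
    simpa using integrable_pow_mul_exp_of_mem_interior_integrableExpSet hθ 1

omit hsteep in
lemma mean_eq {θ : ℝ} (hθ : θ ∈ params (carrier ρ h)) :
    mean ρ h θ = deriv (cgf id (carrier ρ h)) θ := by
  rw [mean, law_eq_tilted hh hm, integral_id_tilted hθ]
  rw [naturalParams_eq hh]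
  exact interior_subset hθ

lemma meanSet_eq : meanSet ρ h = deriv (cgf id (carrier ρ h)) '' params (carrier ρ h) := by
  rw [meanSet, finiteMeanParams_eq hh hsteep hm]
  exact image_congr fun θ hθ => mean_eq hh hm hθ

lemma ordConnected_meanSet : OrdConnected (meanSet ρ h) := by
  rw [meanSet_eq hh hsteep hm]
  exact (convex_params.isPreconnected.image _ continuousOn_deriv_cgf).ordConnected

lemma strictMonoOn_mean (hnt : (meanSet ρ h).Nontrivial) :
    StrictMonoOn (deriv (cgf id (carrier ρ h))) (params (carrier ρ h)) := by
  rw [meanSet_eq hh hsteep hm] at hnt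
  obtain ⟨_, ⟨θ, hθ, rfl⟩, _, ⟨φ, hφ, rfl⟩, hne⟩ := hnt
  exact strictMonoOn_deriv_cgf hm hθ hφ hne

/-- Strict monotonicity of the mean makes the parameter chosen by `Function.invFunOn` the given one.
-/
lemma lawOfMean_eq (hnt : (meanSet ρ h).Nontrivial) {θ : ℝ} (hθ : θ ∈ params (carrier ρ h)) :
    lawOfMean ρ h (deriv (cgf id (carrier ρ h)) θ) = (carrier ρ h).tilted (fun x => θ * x) := by
  have hmem : deriv (cgf id (carrier ρ h)) θ ∈ mean ρ h '' finiteMeanParams ρ h := by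
    rw [← meanSet, meanSet_eq hh hsteep hm]
    exact mem_image_of_mem _ hθ
  have h1 := Function.invFunOn_mem hmem
  have h2 := Function.invFunOn_eq hmem
  rw [finiteMeanParams_eq hh hsteep hm] at h1 h2
  rw [mean_eq hh hm h1] at h2
  rw [lawOfMean, finiteMeanParams_eq hh hsteep hm, law_eq_tilted hh hm]
  · rw [(strictMonoOn_mean hh hsteep hm hnt).injOn h1 hθ h2]
  · rw [naturalParams_eq hh]
    exact interior_subset h1

lemma divergence_eq (hnt : (meanSet ρ h).Nontrivial) {θ φ : ℝ} (hθ : θ ∈ params (carrier ρ h))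
    (hφ : φ ∈ params (carrier ρ h)) :
    divergence ρ h (deriv (cgf id (carrier ρ h)) θ) (deriv (cgf id (carrier ρ h)) φ)
      = ENNReal.ofReal (breg (carrier ρ h) θ φ) := by
  rw [divergence, lawOfMean_eq hh hsteep hm hnt hθ, lawOfMean_eq hh hsteep hm hnt hφ,
    klDiv_tilted hm hθ hφ]

/-- In a steep family all laws are carried by the closure of the set of means. -/
lemma ae_mem_closure_meanSet (hne : (meanSet ρ h).Nonempty) :
    ∀ᵐ x ∂(carrier ρ h), x ∈ closure (meanSet ρ h) := by
  set m := carrier ρ h with hmdef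
  have hI := meanSet_eq hh hsteep hm
  have hne' := hne
  rw [hI] at hne'
  obtain ⟨_, ⟨θ₀, hθ₀, rfl⟩⟩ := hne'
  have hfin : ∀ θ, θ ∈ params m ↔ Integrable (fun x => Real.exp (θ * x)) m ∧
      Integrable (fun x => x * Real.exp (θ * x)) m := fun θ => by
    rw [← mem_finiteMeanParams_iff hh hm, finiteMeanParams_eq hh hsteep hm]
  have hmeanInt : ∀ θ ∈ params m, ∫ x, x * Real.exp (θ * x) ∂m
      = deriv (cgf id m) θ * ∫ x, Real.exp (θ * x) ∂m := by
    intro θ hθ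
    have hpos : 0 < mgf id m θ := mgf_pos' hm (integrable_exp hθ)
    rw [deriv_cgf hθ]
    simp only [mgf, id] at hpos ⊢
    rw [div_mul_cancel₀ _ hpos.ne']
  have hup : BddAbove (meanSet ρ h) → ∀ᵐ x ∂m, x ≤ sSup (meanSet ρ h) := by
    intro hb
    set R := sSup (meanSet ρ h)
    have hexp : ∀ θ x : ℝ, Real.exp (θ * (x - R)) = Real.exp (-(θ * R)) * Real.exp (θ * x) := by
      intro θ x; rw [← Real.exp_add]; ring_nf
    have key := ae_nonpos_of_steep (μ := m) (Y := fun x => x - R) (by fun_prop)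
      (isOpen_params (m := m)) hθ₀ ?_ ?_ ?_ ?_
    · filter_upwards [key] with x hx using by linarith
    · intro θ hθ
      simp only [hexp]
      exact (integrable_exp hθ).const_mul _
    · intro θ hθ
      refine ((((hfin θ).1 hθ).2.sub ((integrable_exp hθ).const_mul R)).const_mul
        (Real.exp (-(θ * R)))).congr (ae_of_all _ fun x => ?_)
      simp only [hexp, Pi.sub_apply]
      ring
    · intro θ hθ
      have e : ∀ x : ℝ, (x - R) * Real.exp (θ * (x - R))
          = Real.exp (-(θ * R)) * (x * Real.exp (θ * x) - R * Real.exp (θ * x)) := by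
        intro x; rw [hexp]; ring
      simp only [e]
      rw [integral_const_mul, integral_sub ((hfin θ).1 hθ).2 ((integrable_exp hθ).const_mul R),
        hmeanInt θ hθ, integral_const_mul, ← sub_mul]
      refine mul_nonpos_of_nonneg_of_nonpos (Real.exp_pos _).le
        (mul_nonpos_of_nonpos_of_nonneg ?_ (integral_nonneg fun x => (Real.exp_pos _).le))
      exact sub_nonpos.2 (le_csSup hb (hI ▸ mem_image_of_mem _ hθ))
    · intro θ h1 h2
      have h1' : Integrable (fun x => Real.exp (θ * x)) m := by
        refine (h1.const_mul (Real.exp (θ * R))).congr (ae_of_all _ fun x => ?_)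
        simp only [← Real.exp_add]; ring_nf
      refine (hfin θ).2 ⟨h1', ?_⟩
      refine ((h2.const_mul (Real.exp (θ * R))).add (h1'.const_mul R)).congr
        (ae_of_all _ fun x => ?_)
      have : Real.exp (θ * R) * Real.exp (-(θ * R)) = 1 := by rw [← Real.exp_add]; simp
      simp only [hexp, Pi.add_apply]
      linear_combination (x - R) * Real.exp (θ * x) * this
  have hlow : BddBelow (meanSet ρ h) → ∀ᵐ x ∂m, sInf (meanSet ρ h) ≤ x := by
    intro hb
    set R := sInf (meanSet ρ h)
    have hexp : ∀ θ x : ℝ, Real.exp (-θ * (R - x)) = Real.exp (-(θ * R)) * Real.exp (θ * x) := by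
      intro θ x; rw [← Real.exp_add]; ring_nf
    have hexp' : ∀ θ x : ℝ, Real.exp (θ * (R - x)) = Real.exp (θ * R) * Real.exp (-θ * x) := by
      intro θ x; rw [← Real.exp_add]; ring_nf
    -- The lower end is the upper end of the reflected family, whose parameters are the negatives.
    have key := ae_nonpos_of_steep (μ := m) (Y := fun x => R - x) (by fun_prop)
      (J := {θ | -θ ∈ params m}) ((isOpen_params (m := m)).preimage continuous_neg)
      (θ₀ := -θ₀) (by simpa using hθ₀) ?_ ?_ ?_ ?_
    · filter_upwards [key] with x hx using by linarith
    · intro θ hθ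
      simp only [hexp']
      exact (integrable_exp hθ).const_mul _
    · intro θ hθ
      refine ((((integrable_exp hθ).const_mul R).sub ((hfin (-θ)).1 hθ).2).const_mul
        (Real.exp (θ * R))).congr (ae_of_all _ fun x => ?_)
      simp only [hexp', Pi.sub_apply]
      ring
    · intro θ hθ
      have e : ∀ x : ℝ, (R - x) * Real.exp (θ * (R - x))
          = Real.exp (θ * R) * (R * Real.exp (-θ * x) - x * Real.exp (-θ * x)) := by
        intro x; rw [hexp']; ring
      simp only [e]
      rw [integral_const_mul, integral_sub ((integrable_exp hθ).const_mul R) ((hfin (-θ)).1 hθ).2,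
        hmeanInt (-θ) hθ, integral_const_mul, ← sub_mul]
      refine mul_nonpos_of_nonneg_of_nonpos (Real.exp_pos _).le
        (mul_nonpos_of_nonpos_of_nonneg ?_ (integral_nonneg fun x => (Real.exp_pos _).le))
      exact sub_nonpos.2 (csInf_le hb (hI ▸ mem_image_of_mem _ hθ))
    · intro θ h1 h2
      have h1' : Integrable (fun x => Real.exp (-θ * x)) m := by
        refine (h1.const_mul (Real.exp (-(θ * R)))).congr (ae_of_all _ fun x => ?_)
        simp only [← Real.exp_add]; ring_nf
      refine (hfin (-θ)).2 ⟨h1', ?_⟩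
      refine ((h1'.const_mul R).sub (h2.const_mul (Real.exp (-(θ * R))))).congr
        (ae_of_all _ fun x => ?_)
      have : Real.exp (θ * R) * Real.exp (-(θ * R)) = 1 := by rw [← Real.exp_add]; simp
      simp only [hexp', Pi.sub_apply]
      linear_combination (x - R) * Real.exp (-θ * x) * this
  have hpure : ∀ x : ℝ, (BddAbove (meanSet ρ h) → x ≤ sSup (meanSet ρ h)) →
      (BddBelow (meanSet ρ h) → sInf (meanSet ρ h) ≤ x) → x ∈ closure (meanSet ρ h) := by
    intro x h1 h2
    by_contra hx
    have hxI : x ∉ meanSet ρ h := fun h => hx (subset_closure h)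
    have hside : (∀ y ∈ meanSet ρ h, y ≤ x) ∨ (∀ y ∈ meanSet ρ h, x ≤ y) := by
      by_contra! hc
      obtain ⟨⟨y, hy, hxy⟩, z, hz, hzx⟩ := hc
      exact hxI ((ordConnected_meanSet hh hsteep hm).out hz hy ⟨hzx.le, hxy.le⟩)
    rcases hside with hs | hs
    · have hb : BddAbove (meanSet ρ h) := ⟨x, hs⟩
      have : x = sSup (meanSet ρ h) := le_antisymm (h1 hb) (csSup_le hne hs)
      exact hx (this ▸ csSup_mem_closure hne hb)
    · have hb : BddBelow (meanSet ρ h) := ⟨x, hs⟩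
      have : x = sInf (meanSet ρ h) := le_antisymm (le_csInf hne hs) (h2 hb)
      exact hx (this ▸ csInf_mem_closure hne hb)
  have hup' : ∀ᵐ x ∂m, BddAbove (meanSet ρ h) → x ≤ sSup (meanSet ρ h) := by
    by_cases hb : BddAbove (meanSet ρ h)
    · filter_upwards [hup hb] with x hx _ using hx
    · exact ae_of_all _ fun x hb' => absurd hb' hb
  have hlow' : ∀ᵐ x ∂m, BddBelow (meanSet ρ h) → sInf (meanSet ρ h) ≤ x := by
    by_cases hb : BddBelow (meanSet ρ h)
    · filter_upwards [hlow hb] with x hx _ using hx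
    · exact ae_of_all _ fun x hb' => absurd hb' hb
  filter_upwards [hup', hlow'] with x h1 h2 using hpure x h1 h2

end Steep

end ExpFamily

/-! ### The extended divergence and the KL-UCB index -/

namespace ExpFamily

open Set ExpTilt

variable {ρ : Measure ℝ} {h : ℝ → ℝ≥0}

section Steep

variable (hh : Measurable h) (hsteep : IsSteep ρ h) (hnt : (meanSet ρ h).Nontrivial)
include hh hsteep hnt

lemma mean_mem_meanSet {θ : ℝ} (hθ : θ ∈ params (carrier ρ h)) : mean ρ h θ ∈ meanSet ρ h := by
  rw [mean_eq hh (carrier_ne_zero hh hnt) hθ, meanSet_eq hh hsteep (carrier_ne_zero hh hnt)]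
  exact mem_image_of_mem _ hθ

lemma exists_mean_eq {z : ℝ} (hz : z ∈ meanSet ρ h) :
    ∃ θ ∈ params (carrier ρ h), mean ρ h θ = z := by
  obtain ⟨θ, hθ, rfl⟩ := hz
  exact ⟨θ, finiteMeanParams_eq hh hsteep (carrier_ne_zero hh hnt) ▸ hθ, rfl⟩

lemma strictMonoOn_deriv : StrictMonoOn (deriv (cgf id (carrier ρ h))) (params (carrier ρ h)) :=
  strictMonoOn_mean hh hsteep (carrier_ne_zero hh hnt) hnt

lemma mean_strictMonoOn : StrictMonoOn (mean ρ h) (params (carrier ρ h)) :=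
  (strictMonoOn_deriv hh hsteep hnt).congr fun _ hθ =>
    (mean_eq hh (carrier_ne_zero hh hnt) hθ).symm

lemma divergence_mean {θ φ : ℝ} (hθ : θ ∈ params (carrier ρ h)) (hφ : φ ∈ params (carrier ρ h)) :
    divergence ρ h (mean ρ h θ) (mean ρ h φ) = ENNReal.ofReal (breg (carrier ρ h) θ φ) := by
  rw [mean_eq hh (carrier_ne_zero hh hnt) hθ, mean_eq hh (carrier_ne_zero hh hnt) hφ,
    divergence_eq hh hsteep (carrier_ne_zero hh hnt) hnt hθ hφ]

lemma lawOfMean_mean {θ : ℝ} (hθ : θ ∈ params (carrier ρ h)) :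
    lawOfMean ρ h (mean ρ h θ) = (carrier ρ h).tilted (fun x => θ * x) := by
  rw [mean_eq hh (carrier_ne_zero hh hnt) hθ,
    lawOfMean_eq hh hsteep (carrier_ne_zero hh hnt) hnt hθ]

/-- At end points the divergence is only a liminf, so it is controlled through parameters strictly
inside: pairs of means near `(y, w)` straddle `θ ≤ φ`, and the divergence grows as its arguments
move apart. -/
lemma le_divergenceExt {θ φ y w : ℝ} (hθ : θ ∈ params (carrier ρ h))
    (hφ : φ ∈ params (carrier ρ h)) (hθφ : θ ≤ φ) (hy : y < mean ρ h θ) (hw : mean ρ h φ < w) :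
    ENNReal.ofReal (breg (carrier ρ h) θ φ) ≤ divergenceExt ρ h y w := by
  have hmono := mean_strictMonoOn hh hsteep hnt
  have hM := strictMonoOn_deriv hh hsteep hnt
  refine le_liminf_of_le (by isBoundedDefault) ?_
  have h1 : ∀ᶠ p : ℝ × ℝ in 𝓝 (y, w), p.1 < mean ρ h θ :=
    continuous_fst.continuousAt.eventually_lt_const hy
  have h2 : ∀ᶠ p : ℝ × ℝ in 𝓝 (y, w), mean ρ h φ < p.2 :=
    continuous_snd.continuousAt.eventually_const_lt hw
  filter_upwards [nhdsWithin_le_nhds h1, nhdsWithin_le_nhds h2, self_mem_nhdsWithin]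
    with p hp1 hp2 hp
  obtain ⟨θ', hθ', hp1'⟩ := exists_mean_eq hh hsteep hnt hp.1
  obtain ⟨φ', hφ', hp2'⟩ := exists_mean_eq hh hsteep hnt hp.2
  rw [← hp1'] at hp1
  rw [← hp2'] at hp2
  have l1 : θ' < θ := (hmono.lt_iff_lt hθ' hθ).1 hp1
  have l2 : φ < φ' := (hmono.lt_iff_lt hφ hφ').1 hp2
  rw [← hp1', ← hp2', divergence_mean hh hsteep hnt hθ' hφ']
  exact ENNReal.ofReal_le_ofReal ((breg_mono_right hM hθ hφ hφ' hθφ l2.le).trans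
    (breg_anti_left hM hθ' hθ l1.le (hθφ.trans l2.le)))

/-- The divergence is zero along the diagonal, and this bounds the liminf. It makes every index at
least the sample mean. -/
lemma divergenceExt_self {y : ℝ} (hy : y ∈ closure (meanSet ρ h)) :
    divergenceExt ρ h y y = 0 := by
  have hne : (𝓝[meanSet ρ h] y).NeBot := mem_closure_iff_nhdsWithin_neBot.1 hy
  refine le_antisymm (liminf_le_of_frequently_le' ?_) bot_le
  have htend : Tendsto (fun z : ℝ => (z, z)) (𝓝[meanSet ρ h] y)
      (𝓝[meanSet ρ h ×ˢ meanSet ρ h] (y, y)) := by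
    refine tendsto_nhdsWithin_iff.2 ⟨?_, ?_⟩
    · exact ((continuous_id.prodMk continuous_id).tendsto y).mono_left nhdsWithin_le_nhds
    · filter_upwards [self_mem_nhdsWithin] with z hz using ⟨hz, hz⟩
  refine htend.frequently (Eventually.frequently ?_)
  filter_upwards [self_mem_nhdsWithin] with z hz
  obtain ⟨θ, hθ, rfl⟩ := exists_mean_eq hh hsteep hnt hz
  rw [divergence_mean hh hsteep hnt hθ hθ, breg_self]
  simp

lemma klucbIndex_le {θ φ y : ℝ} {n t : ℕ} (hθ : θ ∈ params (carrier ρ h))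
    (hφ : φ ∈ params (carrier ρ h)) (hθφ : θ ≤ φ) (hy : y < mean ρ h θ)
    (hlt : Real.log t / n < breg (carrier ρ h) θ φ) (hpos : 0 < breg (carrier ρ h) θ φ) :
    klucbIndex ρ h y n t ≤ (mean ρ h φ : EReal) := by
  refine sSup_le ?_
  rintro _ ⟨w, ⟨-, hw⟩, rfl⟩
  by_contra hc
  rw [not_le, EReal.coe_lt_coe_iff] at hc
  have h1 := (le_divergenceExt hh hsteep hnt hθ hφ hθφ hy hc).trans hw
  exact absurd h1 (not_le.2 ((ENNReal.ofReal_lt_ofReal_iff hpos).2 hlt))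

lemma le_klucbIndex {y : ℝ} (hy : y ∈ closure (meanSet ρ h)) (n t : ℕ) :
    (y : EReal) ≤ klucbIndex ρ h y n t :=
  le_sSup ⟨y, ⟨hy, by rw [divergenceExt_self hh hsteep hnt hy]; exact bot_le⟩, rfl⟩

/-- If the index of an arm is at most `w < w'`, then its sample mean is dominated by some mean `z`
of the family for which the divergence from `z` to `w'` exceeds the exploration level. -/
lemma exists_of_klucbIndex_le {φ χ y : ℝ} {n t : ℕ} (hφ : φ ∈ params (carrier ρ h))
    (hχ : χ ∈ params (carrier ρ h)) (hφχ : φ < χ) (hy : y ∈ closure (meanSet ρ h))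
    (hidx : klucbIndex ρ h y n t ≤ (mean ρ h φ : EReal)) :
    ∃ θ ∈ params (carrier ρ h), y ≤ mean ρ h θ ∧ θ < χ ∧
      Real.log t / n < breg (carrier ρ h) θ χ := by
  have hmono := mean_strictMonoOn hh hsteep hnt
  have hne : (𝓝[meanSet ρ h] y).NeBot := mem_closure_iff_nhdsWithin_neBot.1 hy
  have hφχ' := hmono hφ hχ hφχ
  have hyφ : y ≤ mean ρ h φ :=
    EReal.coe_le_coe_iff.1 ((le_klucbIndex hh hsteep hnt hy n t).trans hidx)
  have hχI := mean_mem_meanSet hh hsteep hnt hχ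
  have hlt : ENNReal.ofReal (Real.log t / n) < divergenceExt ρ h y (mean ρ h χ) := by
    by_contra hc
    have h1 : ((mean ρ h χ : ℝ) : EReal) ≤ klucbIndex ρ h y n t :=
      le_sSup ⟨mean ρ h χ, ⟨subset_closure hχI, not_lt.1 hc⟩, rfl⟩
    exact absurd (EReal.coe_le_coe_iff.1 (h1.trans hidx)) (not_le.2 hφχ')
  have hev := eventually_lt_of_lt_liminf hlt
  have htend : Tendsto (fun z : ℝ => (z, mean ρ h χ)) (𝓝[meanSet ρ h] y)
      (𝓝[meanSet ρ h ×ˢ meanSet ρ h] (y, mean ρ h χ)) := by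
    refine tendsto_nhdsWithin_iff.2 ⟨?_, ?_⟩
    · exact ((continuous_id.prodMk continuous_const).tendsto y).mono_left nhdsWithin_le_nhds
    · filter_upwards [self_mem_nhdsWithin] with z hz using ⟨hz, hχI⟩
  have hev' := htend.eventually hev
  have hltχ : ∀ᶠ z in 𝓝[meanSet ρ h] y, z < mean ρ h χ :=
    nhdsWithin_le_nhds (eventually_lt_nhds (hyφ.trans_lt hφχ'))
  have hall := hev'.and (hltχ.and self_mem_nhdsWithin)
  obtain ⟨z, hyz, hz1, hz2, hz3⟩ : ∃ z, y ≤ z ∧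
      ENNReal.ofReal (Real.log t / n) < divergence ρ h z (mean ρ h χ) ∧ z < mean ρ h χ ∧
      z ∈ meanSet ρ h := by
    -- If `y` is not itself a mean, no mean lies below it, since the means form an interval
    -- containing `mean ρ h χ ≥ y`; so any nearby mean serves as `z`.
    by_cases hyI : y ∈ meanSet ρ h
    · exact ⟨y, le_rfl, hall.self_of_nhdsWithin hyI⟩
    · obtain ⟨z, hz⟩ := hall.exists
      refine ⟨z, ?_, hz⟩
      by_contra hc
      exact hyI ((ordConnected_meanSet hh hsteep (carrier_ne_zero hh hnt)).out hz.2.2 hχI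
        ⟨(not_le.1 hc).le, (hyφ.trans hφχ'.le)⟩)
  obtain ⟨θ, hθ, rfl⟩ := exists_mean_eq hh hsteep hnt hz3
  rw [divergence_mean hh hsteep hnt hθ hχ] at hz1
  exact ⟨θ, hθ, hyz, (hmono.lt_iff_lt hθ hχ).1 hz2, (ENNReal.ofReal_lt_ofReal_iff'.1 hz1).1⟩

end Steep

end ExpFamily

/-! ### The tail exponent -/

namespace ExpFamily

open Set ExpTilt

variable {ρ : Measure ℝ} {h : ℝ → ℝ≥0}

lemma exists_mem_params_lt {m : Measure ℝ} {θ : ℝ} (hθ : θ ∈ params m) :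
    ∃ φ ∈ params m, φ < θ := by
  have h1 : ∀ᶠ φ in 𝓝[<] θ, φ ∈ params m := nhdsWithin_le_nhds (isOpen_params.mem_nhds hθ)
  obtain ⟨φ, hφ, hlt⟩ := (h1.and self_mem_nhdsWithin).exists
  exact ⟨φ, hφ, hlt⟩

section Steep

variable (hh : Measurable h) (hsteep : IsSteep ρ h) (hnt : (meanSet ρ h).Nontrivial)
include hh hsteep hnt

lemma toReal_divergence_mean {θ φ : ℝ} (hθ : θ ∈ params (carrier ρ h))
    (hφ : φ ∈ params (carrier ρ h)) :
    (divergence ρ h (mean ρ h θ) (mean ρ h φ)).toReal = breg (carrier ρ h) θ φ := by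
  rw [divergence_mean hh hsteep hnt hθ hφ,
    ENNReal.toReal_ofReal (breg_nonneg (strictMonoOn_deriv hh hsteep hnt) hθ hφ)]

variable {θ₁ θ₂ : ℝ} (h1 : θ₁ ∈ params (carrier ρ h)) (h2 : θ₂ ∈ params (carrier ρ h))
include h1 h2

lemma tailExponent_le {θ : ℝ} (hθ : θ ∈ params (carrier ρ h)) (hlt : θ < θ₂) :
    tailExponent ρ h (mean ρ h θ₁) (mean ρ h θ₂)
      ≤ breg (carrier ρ h) θ θ₁ / breg (carrier ρ h) θ θ₂ := by
  rw [← toReal_divergence_mean hh hsteep hnt hθ h1, ← toReal_divergence_mean hh hsteep hnt hθ h2]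
  exact ciInf_le (f := fun z : {z : ℝ // z ∈ meanSet ρ h ∧ z < mean ρ h θ₂} =>
    (divergence ρ h z (mean ρ h θ₁)).toReal / (divergence ρ h z (mean ρ h θ₂)).toReal)
    ⟨0, by rintro _ ⟨z, rfl⟩; positivity⟩
    ⟨mean ρ h θ, mean_mem_meanSet hh hsteep hnt hθ, mean_strictMonoOn hh hsteep hnt hθ h2 hlt⟩

omit h1 in
lemma nonempty_meanSet_lt : Nonempty {z : ℝ // z ∈ meanSet ρ h ∧ z < mean ρ h θ₂} := by
  obtain ⟨θ, hθ, hlt⟩ := exists_mem_params_lt h2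
  exact ⟨⟨mean ρ h θ, mean_mem_meanSet hh hsteep hnt hθ,
    mean_strictMonoOn hh hsteep hnt hθ h2 hlt⟩⟩

lemma exists_ratio_lt {c : ℝ} (hc : tailExponent ρ h (mean ρ h θ₁) (mean ρ h θ₂) < c) :
    ∃ θ ∈ params (carrier ρ h), θ < θ₂ ∧
      breg (carrier ρ h) θ θ₁ / breg (carrier ρ h) θ θ₂ < c := by
  have := nonempty_meanSet_lt hh hsteep hnt h2
  obtain ⟨⟨z, hz, hlt⟩, hz'⟩ := exists_lt_of_ciInf_lt hc
  obtain ⟨θ, hθ, rfl⟩ := exists_mean_eq hh hsteep hnt hz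
  refine ⟨θ, hθ, ((mean_strictMonoOn hh hsteep hnt).lt_iff_lt hθ h2).1 hlt, ?_⟩
  simpa only [toReal_divergence_mean hh hsteep hnt hθ h1,
    toReal_divergence_mean hh hsteep hnt hθ h2] using hz'

lemma le_tailExponent {c : ℝ} (hc : ∀ θ ∈ params (carrier ρ h), θ < θ₂ →
    c * breg (carrier ρ h) θ θ₂ ≤ breg (carrier ρ h) θ θ₁) :
    c ≤ tailExponent ρ h (mean ρ h θ₁) (mean ρ h θ₂) := by
  by_contra hlt
  obtain ⟨θ, hθ, hlt, hr⟩ := exists_ratio_lt hh hsteep hnt h1 h2 (not_le.1 hlt)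
  have hpos := breg_pos (strictMonoOn_deriv hh hsteep hnt) hθ h2 hlt.ne
  rw [div_lt_iff₀ hpos] at hr
  exact absurd (hc θ hθ hlt) (not_le.2 hr)

lemma one_le_tailExponent (h21 : θ₂ < θ₁) :
    1 ≤ tailExponent ρ h (mean ρ h θ₁) (mean ρ h θ₂) := by
  refine le_tailExponent hh hsteep hnt h1 h2 fun θ hθ hlt => ?_
  rw [one_mul]
  exact breg_mono_right (strictMonoOn_deriv hh hsteep hnt) hθ h2 h1 hlt.le h21.le

/-- Right continuity of the tail exponent in the suboptimal mean, uniformly over the lower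
means. -/
lemma exists_breg_le (h21 : θ₂ < θ₁) {η : ℝ} (hη : 0 < η) :
    ∃ χ ∈ params (carrier ρ h), θ₂ < χ ∧ χ < θ₁ ∧ ∀ θ ∈ params (carrier ρ h), θ < χ →
      breg (carrier ρ h) θ χ ≤
        (1 / tailExponent ρ h (mean ρ h θ₁) (mean ρ h θ₂) + η) * breg (carrier ρ h) θ θ₁ := by
  set m := carrier ρ h
  have hM := strictMonoOn_deriv hh hsteep hnt
  have hκ := one_le_tailExponent hh hsteep hnt h1 h2 h21
  set κ := tailExponent ρ h (mean ρ h θ₁) (mean ρ h θ₂)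
  have hB := breg_pos hM h2 h1 h21.ne
  -- `χ` is taken so close to `θ₂` that each term which the three-point identity adds in passing
  -- from `θ₂` to `χ` is at most `η` times its counterpart for `θ₁`.
  have ev1 : ∀ᶠ χ in 𝓝 θ₂, breg m θ₂ χ < η * breg m χ θ₁ := by
    have c1 : ContinuousAt (fun χ => breg m θ₂ χ) θ₂ := continuousAt_breg_right h2
    have c2 : ContinuousAt (fun χ => η * breg m χ θ₁) θ₂ := by
      refine continuousAt_const.mul ?_
      exact ContinuousAt.comp (f := fun χ : ℝ => (χ, θ₁)) (g := fun p : ℝ × ℝ => breg m p.1 p.2)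
        (continuousAt_breg h2 h1) (by fun_prop)
    refine c1.eventually_lt c2 ?_
    rw [breg_self]
    positivity
  have ev2 : ∀ᶠ χ in 𝓝 θ₂, χ - θ₂ < η * (θ₁ - θ₂) := by
    refine ContinuousAt.eventually_lt (by fun_prop) (by fun_prop) ?_
    rw [sub_self]
    exact mul_pos hη (by linarith)
  have ev3 : ∀ᶠ χ in 𝓝 θ₂, χ < θ₁ := eventually_lt_nhds h21
  have ev4 : ∀ᶠ χ in 𝓝 θ₂, χ ∈ params m := isOpen_params.mem_nhds h2
  have ev : ∀ᶠ χ in 𝓝[>] θ₂, breg m θ₂ χ < η * breg m χ θ₁ ∧ χ - θ₂ < η * (θ₁ - θ₂) ∧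
      χ < θ₁ ∧ χ ∈ params m := nhdsWithin_le_nhds (ev1.and (ev2.and (ev3.and ev4)))
  obtain ⟨χ, ⟨e1, e2, e3, e4⟩, hχ⟩ := (ev.and self_mem_nhdsWithin).exists
  refine ⟨χ, e4, hχ, e3, fun θ hθ hlt => ?_⟩
  have hb1 := breg_nonneg hM hθ h1
  have hκ' : 0 ≤ 1 / κ * breg m θ θ₁ := by positivity
  rw [add_mul]
  rcases lt_or_ge θ θ₂ with hθ2 | hθ2
  · have hr := tailExponent_le hh hsteep hnt h1 h2 hθ hθ2
    have hp2 := breg_pos hM hθ h2 hθ2.ne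
    have hr' : breg m θ θ₂ ≤ 1 / κ * breg m θ θ₁ := by
      rw [le_div_iff₀ hp2] at hr
      rw [one_div, ← div_eq_inv_mul, le_div_iff₀ (by linarith)]
      linarith
    have i1 := breg_eq_add m θ θ₂ χ
    have i2 := breg_eq_add m θ θ₂ θ₁
    have i3 := breg_anti_left hM h2 e4 hχ.le e3.le
    have i4 := hM.monotoneOn hθ h2 hθ2.le
    have i5 : (χ - θ₂) * (deriv (cgf id m) θ₂ - deriv (cgf id m) θ) ≤
        η * (θ₁ - θ₂) * (deriv (cgf id m) θ₂ - deriv (cgf id m) θ) :=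
      mul_le_mul_of_nonneg_right e2.le (by linarith)
    have i6 : η * breg m χ θ₁ ≤ η * breg m θ₂ θ₁ := by gcongr
    have i7 : η * breg m θ θ₁ = η * breg m θ θ₂ + η * breg m θ₂ θ₁
        + η * (θ₁ - θ₂) * (deriv (cgf id m) θ₂ - deriv (cgf id m) θ) := by rw [i2]; ring
    have i8 : 0 ≤ η * breg m θ θ₂ := by positivity
    linarith
  · have i1 := breg_anti_left hM h2 hθ hθ2 hlt.le
    have i2 := breg_anti_left hM hθ e4 hlt.le e3.le
    have i3 : η * breg m χ θ₁ ≤ η * breg m θ θ₁ := by gcongr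
    linarith

/-- Nearly optimal parameters with some room on both sides. -/
lemma exists_ratio_lt_of_slack {c : ℝ}
    (hc : tailExponent ρ h (mean ρ h θ₁) (mean ρ h θ₂) < c) :
    ∃ θ ∈ params (carrier ρ h), ∃ ψ ∈ params (carrier ρ h), ∃ φ ∈ params (carrier ρ h),
      ∃ χ ∈ params (carrier ρ h), θ < ψ ∧ ψ < φ ∧ φ < χ ∧ χ < θ₂ ∧
        breg (carrier ρ h) θ θ₁ / breg (carrier ρ h) ψ φ < c := by
  set m := carrier ρ h
  have hM := strictMonoOn_deriv hh hsteep hnt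
  obtain ⟨θ, hθ, hlt, hr⟩ := exists_ratio_lt hh hsteep hnt h1 h2 hc
  have hpos := breg_pos hM hθ h2 hlt.ne
  -- The witnesses are `θ`, `θ + s`, `θ₂ - 2 * s` and `θ₂ - s`; the ratio is continuous at `s = 0`.
  have c1 : ContinuousAt (fun s : ℝ => breg m θ θ₁ / breg m (θ + s) (θ₂ - 2 * s)) 0 := by
    refine continuousAt_const.div ?_ (by simpa using hpos.ne')
    refine ContinuousAt.comp (f := fun s : ℝ => (θ + s, θ₂ - 2 * s))
      (g := fun p : ℝ × ℝ => breg m p.1 p.2) ?_ (by fun_prop)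
    simpa using continuousAt_breg hθ h2
  have ev1 : ∀ᶠ s : ℝ in 𝓝 0, breg m θ θ₁ / breg m (θ + s) (θ₂ - 2 * s) < c :=
    c1.eventually_lt continuousAt_const (by simpa using hr)
  have ev2 : ∀ᶠ s : ℝ in 𝓝 0, θ + s < θ₂ - 2 * s :=
    ContinuousAt.eventually_lt (by fun_prop) (by fun_prop) (by simpa using hlt)
  have ev : ∀ᶠ s : ℝ in 𝓝[>] 0, breg m θ θ₁ / breg m (θ + s) (θ₂ - 2 * s) < c ∧
      θ + s < θ₂ - 2 * s := nhdsWithin_le_nhds (ev1.and ev2)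
  obtain ⟨s, ⟨e1, e2⟩, hs⟩ := (ev.and self_mem_nhdsWithin).exists
  have hmem : ∀ x, θ ≤ x → x ≤ θ₂ → x ∈ params m := fun x hx1 hx2 =>
    ordConnected_params.out hθ h2 ⟨hx1, hx2⟩
  exact ⟨θ, hθ, θ + s, hmem _ (by linarith) (by linarith), θ₂ - 2 * s,
    hmem _ (by linarith) (by linarith), θ₂ - s, hmem _ (by linarith) (by linarith),
    by linarith, e2, by linarith, by linarith, e1⟩

/-- By the three-point identity it suffices that `breg θ θ₂` is at most a multiple of a positive
constant plus the gap between the means. If the parameters are bounded below, the factor `θ₂ - θ` is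
bounded; otherwise θ A'(θ) - A(θ) stays bounded above as θ → -∞. -/
lemma one_lt_tailExponent (h21 : θ₂ < θ₁) (hleft : ¬ LeftTailCondition ρ h) :
    1 < tailExponent ρ h (mean ρ h θ₁) (mean ρ h θ₂) := by
  set m := carrier ρ h with hmdef
  have hM := strictMonoOn_deriv hh hsteep hnt
  have hB := breg_pos hM h2 h1 h21.ne
  suffices hsuff : ∃ c : ℝ, 0 < c ∧ ∀ θ ∈ params m, θ < θ₂ →
      c * breg m θ θ₂ ≤ breg m θ₂ θ₁
        + (θ₁ - θ₂) * (deriv (cgf id m) θ₂ - deriv (cgf id m) θ) by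
    obtain ⟨c, hc, hle⟩ := hsuff
    refine (lt_add_of_pos_right 1 hc).trans_le
      (le_tailExponent hh hsteep hnt h1 h2 fun θ hθ hlt => ?_)
    rw [breg_eq_add m θ θ₂ θ₁]
    linarith [hle θ hθ hlt]
  have hu : ∀ θ ∈ params m, θ < θ₂ → 0 ≤ deriv (cgf id m) θ₂ - deriv (cgf id m) θ :=
    fun θ hθ hlt => sub_nonneg.2 (hM.monotoneOn hθ h2 hlt.le)
  by_cases hbdd : BddBelow (naturalParams ρ h)
  · obtain ⟨b, hb⟩ := hbdd
    rw [naturalParams_eq hh] at hb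
    have hbθ : ∀ θ ∈ params m, b ≤ θ := fun θ hθ => hb (interior_subset hθ)
    have hb2 := hbθ θ₂ h2
    have hΔ : 0 < θ₁ - θ₂ := by linarith
    have hden : 0 < θ₂ - b + 1 := by linarith
    refine ⟨(θ₁ - θ₂) / (θ₂ - b + 1), by positivity, fun θ hθ hlt => ?_⟩
    have hsum : breg m θ θ₂ + breg m θ₂ θ
        = (θ₂ - θ) * (deriv (cgf id m) θ₂ - deriv (cgf id m) θ) := by unfold breg; ring
    have i1 := breg_nonneg hM h2 hθ
    have i2 := hu θ hθ hlt
    have i3 : breg m θ θ₂ ≤ (θ₂ - b + 1) * (deriv (cgf id m) θ₂ - deriv (cgf id m) θ) := by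
      have : (θ₂ - θ) * (deriv (cgf id m) θ₂ - deriv (cgf id m) θ) ≤
          (θ₂ - b + 1) * (deriv (cgf id m) θ₂ - deriv (cgf id m) θ) :=
        mul_le_mul_of_nonneg_right (by linarith [hbθ θ hθ]) i2
      linarith
    calc (θ₁ - θ₂) / (θ₂ - b + 1) * breg m θ θ₂
        ≤ (θ₁ - θ₂) / (θ₂ - b + 1)
          * ((θ₂ - b + 1) * (deriv (cgf id m) θ₂ - deriv (cgf id m) θ)) := by gcongr
      _ = (θ₁ - θ₂) * (deriv (cgf id m) θ₂ - deriv (cgf id m) θ) := by field_simp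
      _ ≤ _ := by linarith
  · have hmem : ∀ x ≤ θ₁, x ∈ params m := by
      intro x hx
      rw [naturalParams_eq hh] at hbdd
      obtain ⟨s, hs, hsx⟩ := not_bddBelow_iff.1 hbdd (x - 1)
      have hsub : Icc s θ₁ ⊆ integrableExpSet id m :=
        convex_integrableExpSet.ordConnected.out hs (interior_subset h1)
      rcases hx.lt_or_eq with hx | rfl
      · exact interior_mono hsub (by rw [interior_Icc]; exact ⟨by linarith, hx⟩)
      · exact h1
    have hnt' : ¬ Tendsto (fun θ => θ * deriv (cgf id m) θ - cgf id m θ) atBot atTop := by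
      intro ht
      apply hleft
      refine ⟨hbdd, ?_⟩
      rw [logPartition_eq hh]
      exact ht
    rw [tendsto_atTop] at hnt'
    push Not at hnt'
    obtain ⟨G, hG⟩ := hnt'
    set b := min 0 θ₂ with hbdef
    have hb0 : b ≤ 0 := min_le_left _ _
    have hb2 : b ≤ θ₂ := min_le_right _ _
    have hbJ : b ∈ params m := hmem b (by linarith)
    -- On the negative axis θ A'(θ) - A(θ) is nonincreasing in θ, so values below `G` arbitrarily
    -- far to the left bound it everywhere on this half-line.
    have hg : ∀ θ ≤ b, θ * deriv (cgf id m) θ - cgf id m θ ≤ G := by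
      intro θ hθ
      obtain ⟨θ', hθ', hlt⟩ := (frequently_atBot.1 hG θ)
      have hJ : θ ∈ params m := hmem θ (by linarith)
      have hJ' : θ' ∈ params m := hmem θ' (by linarith)
      have i1 := breg_nonneg hM hJ' hJ
      have i2 := hM.monotoneOn hJ' hJ hθ'
      have i3 : θ * (deriv (cgf id m) θ - deriv (cgf id m) θ') ≤ 0 :=
        mul_nonpos_of_nonpos_of_nonneg (hθ.trans hb0) (by linarith)
      unfold breg at i1
      linarith
    set C := |cgf id m θ₂ + G - θ₂ * deriv (cgf id m) θ₂| with hC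
    set B := breg m θ₂ θ₁
    set E := breg m b θ₂
    have hE : 0 ≤ E := breg_nonneg hM hbJ h2
    have hΔ : 0 < θ₁ - θ₂ := by linarith
    have hC0 : 0 ≤ C := abs_nonneg _
    -- The first two bounds serve `θ ≤ b`, the third serves the remaining range up to `θ₂`, where
    -- the divergence is at most `E`.
    set c := min (min (B / (C + 1)) ((θ₁ - θ₂) / (|θ₂| + 1))) (B / (E + 1)) with hc
    have hc0 : 0 < c := by positivity
    have hc1 : c * (C + 1) ≤ B := by
      rw [← le_div_iff₀ (by positivity)]
      exact (min_le_left _ _).trans (min_le_left _ _)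
    have hc2 : c * (|θ₂| + 1) ≤ θ₁ - θ₂ := by
      rw [← le_div_iff₀ (by positivity)]
      exact (min_le_left _ _).trans (min_le_right _ _)
    have hc3 : c * (E + 1) ≤ B := by
      rw [← le_div_iff₀ (by positivity)]
      exact min_le_right _ _
    refine ⟨c, hc0, fun θ hθ hlt => ?_⟩
    have i2 := hu θ hθ hlt
    set u := deriv (cgf id m) θ₂ - deriv (cgf id m) θ with hudef
    have hΔu : 0 ≤ (θ₁ - θ₂) * u := by positivity
    rcases le_or_gt θ b with hθb | hθb
    · have i1 : breg m θ θ₂ ≤ C + |θ₂| * u := by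
        have j1 := hg θ hθb
        have j2 := le_abs_self (cgf id m θ₂ + G - θ₂ * deriv (cgf id m) θ₂)
        have j3 : θ₂ * u ≤ |θ₂| * u := mul_le_mul_of_nonneg_right (le_abs_self _) i2
        unfold breg
        rw [hudef] at j3 ⊢
        linarith
      have k1 : c * (|θ₂| + 1) * u ≤ (θ₁ - θ₂) * u := mul_le_mul_of_nonneg_right hc2 i2
      have k2 : c * breg m θ θ₂ ≤ c * (C + |θ₂| * u) := by gcongr
      have k3 : 0 ≤ c * u := by positivity
      nlinarith
    · have i1 : breg m θ θ₂ ≤ E := breg_anti_left hM hbJ hθ hθb.le hlt.le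
      have k2 : c * breg m θ θ₂ ≤ c * E := by gcongr
      nlinarith

-- For θ < 0 the bound A'(θ) ≥ L gives θ A'(θ) ≤ θ L, while the atom alone gives A(θ) ≥ log m{L} + θ
-- L; hence θ A'(θ) - A(θ) is bounded above.
omit h2 in
lemma not_leftTailCondition_of_atom {L : ℝ}
    (hL : ∀ᵐ y ∂(lawOfMean ρ h (mean ρ h θ₁)), L ≤ y)
    (hatom : lawOfMean ρ h (mean ρ h θ₁) {L} ≠ 0) : ¬ LeftTailCondition ρ h := by
  rintro ⟨hbdd, htend⟩
  set m := carrier ρ h with hmdef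
  have hm : m ≠ 0 := carrier_ne_zero hh hnt
  rw [lawOfMean_mean hh hsteep hnt h1] at hL hatom
  rw [logPartition_eq hh] at htend
  rw [naturalParams_eq hh] at hbdd
  have hL' : ∀ᵐ y ∂m, L ≤ y := (absolutelyContinuous_tilted (integrable_exp h1)).ae_le hL
  have hmL : m {L} ≠ 0 := fun h0 => hatom (tilted_absolutelyContinuous _ _ h0)
  have hmem : ∀ x < θ₁, x ∈ params m := by
    intro x hx
    obtain ⟨s, hs, hsx⟩ := not_bddBelow_iff.1 hbdd x
    have hsub : Icc s θ₁ ⊆ integrableExpSet id m :=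
      convex_integrableExpSet.ordConnected.out hs (interior_subset h1)
    exact interior_mono hsub (by rw [interior_Icc]; exact ⟨hsx, hx⟩)
  have hmLtop : m {L} ≠ ∞ := by
    have hfin := (integrable_exp h1).measure_ge_lt_top (Real.exp_pos (θ₁ * L))
    refine ((measure_mono ?_).trans_lt hfin).ne
    rintro x hx
    rw [mem_singleton_iff.1 hx]
    exact le_refl (Real.exp (θ₁ * L))
  have hreal : 0 < m.real {L} := ENNReal.toReal_pos hmL hmLtop
  have hbound : ∀ θ < min 0 θ₁, θ * deriv (cgf id m) θ - cgf id m θ ≤ -Real.log (m.real {L}) := by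
    intro θ hθ
    have hθ0 : θ < 0 := hθ.trans_le (min_le_left _ _)
    have hJ : θ ∈ params m := hmem θ (hθ.trans_le (min_le_right _ _))
    have := isProbabilityMeasure_tilted_id hm hJ
    have i1 : L ≤ deriv (cgf id m) θ := by
      rw [← integral_id_tilted hJ]
      have : ∫ _, L ∂(m.tilted (fun x => θ * x)) ≤ ∫ x, x ∂(m.tilted (fun x => θ * x)) :=
        integral_mono_ae (integrable_const _) (integrable_id_tilted hm hJ)
          ((tilted_absolutelyContinuous _ _).ae_le hL')
      simpa using this
    have i2 : m.real {L} * Real.exp (θ * L) ≤ mgf id m θ := by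
      have := setIntegral_le_integral (s := {L}) (integrable_exp hJ)
        (ae_of_all _ fun x => (Real.exp_pos _).le)
      rw [integral_singleton] at this
      simpa [mgf] using this
    have i3 : Real.log (m.real {L}) + θ * L ≤ cgf id m θ := by
      rw [cgf, ← Real.log_exp (θ * L), ← Real.log_mul hreal.ne' (Real.exp_pos _).ne']
      exact Real.log_le_log (by positivity) i2
    nlinarith
  have hev := htend.eventually (eventually_gt_atTop (-Real.log (m.real {L})))
  obtain ⟨θ, hθ, hθ'⟩ := (hev.and (eventually_lt_atBot (min 0 θ₁))).exists
  exact absurd (hbound θ hθ') (not_le.2 hθ)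

end Steep

end ExpFamily

/-! ### Deviations of sums of tilted samples -/

namespace ExpTilt

open Set

variable {m : Measure ℝ} {θ φ ψ : ℝ}

/-- The random variables `Z i` are independent, with the law obtained from `m` by exponential
tilting with parameter `θ`. -/
structure IsTiltedSample {Ω ι : Type*} [MeasurableSpace Ω] (P : Measure Ω) (m : Measure ℝ) (θ : ℝ)
    (Z : ι → Ω → ℝ) : Prop where
  measurable : ∀ i, Measurable (Z i)
  indep : iIndepFun Z P
  law : ∀ i, P.map (Z i) = m.tilted (fun x => θ * x)

namespace IsTiltedSample

variable {Ω ι : Type*} [MeasurableSpace Ω] {P : Measure Ω} [IsProbabilityMeasure P]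
  {Z : ι → Ω → ℝ} (hZ : IsTiltedSample P m θ Z)
include hZ

omit [IsProbabilityMeasure P] in
lemma integrable_exp_mul (hθ : θ ∈ params m) {s : ℝ} (hs : θ + s ∈ params m) (i : ι) :
    Integrable (fun ω => Real.exp (s * Z i ω)) P := by
  have h1 : Integrable (fun x => Real.exp (s * x)) (P.map (Z i)) := by
    rw [hZ.law i, integrable_tilted_iff (integrable_exp hθ)]
    refine (integrable_exp hs).congr (ae_of_all _ fun x => ?_)
    simp only [smul_eq_mul, ← Real.exp_add]
    ring_nf
  exact h1.comp_measurable (hZ.measurable i)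

omit [IsProbabilityMeasure P] in
lemma cgf_eq (hm : m ≠ 0) (hθ : θ ∈ params m) {s : ℝ} (hs : θ + s ∈ params m) (i : ι) :
    cgf (Z i) P s = cgf id m (θ + s) - cgf id m θ := by
  rw [cgf, ← mgf_id_map (hZ.measurable i).aemeasurable, hZ.law i]
  simp only [mgf, id]
  rw [integral_exp_tilted, Real.log_div]
  · have e : (fun x => θ * x) + (fun x => s * x) = fun x => (θ + s) * x := by
      ext x; simp only [Pi.add_apply]; ring
    simp only [e, cgf, mgf, id]
  · have e : (fun x => θ * x) + (fun x => s * x) = fun x => (θ + s) * x := by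
      ext x; simp only [Pi.add_apply]; ring
    simp only [e]
    exact (mgf_pos' hm (integrable_exp hs)).ne'
  · exact (mgf_pos' hm (integrable_exp hθ)).ne'

lemma integrable_exp_mul_sum (hθ : θ ∈ params m) {s : ℝ} (hs : θ + s ∈ params m) (F : Finset ι) :
    Integrable (fun ω => Real.exp (s * (∑ i ∈ F, Z i) ω)) P :=
  hZ.indep.integrable_exp_mul_sum hZ.measurable fun i _ => hZ.integrable_exp_mul hθ hs i

omit [IsProbabilityMeasure P] in
lemma cgf_sum_eq (hm : m ≠ 0) (hθ : θ ∈ params m) {s : ℝ} (hs : θ + s ∈ params m)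
    (F : Finset ι) :
    cgf (∑ i ∈ F, Z i) P s = F.card * (cgf id m (θ + s) - cgf id m θ) := by
  rw [hZ.indep.cgf_sum hZ.measurable fun i _ => hZ.integrable_exp_mul hθ hs i,
    Finset.sum_congr rfl fun i _ => hZ.cgf_eq hm hθ hs i, Finset.sum_const, nsmul_eq_mul]

/-- Chernoff bound for the lower tail of a sum. -/
lemma measure_sum_le_le (hm : m ≠ 0) (hθ : θ ∈ params m) (hψ : ψ ∈ params m) (hle : ψ ≤ θ)
    (F : Finset ι) (b : ℝ) :
    P.real {ω | ∑ i ∈ F, Z i ω ≤ F.card * deriv (cgf id m) ψ - b}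
      ≤ Real.exp (-(F.card * breg m ψ θ) - (θ - ψ) * b) := by
  have hs : θ + (ψ - θ) ∈ params m := by simpa using hψ
  have := measure_le_le_exp_cgf (μ := P) (X := ∑ i ∈ F, Z i) (t := ψ - θ)
    (F.card * deriv (cgf id m) ψ - b) (by linarith) (hZ.integrable_exp_mul_sum hθ hs F)
  rw [hZ.cgf_sum_eq hm hθ hs] at this
  simp only [Finset.sum_apply] at this
  refine this.trans (Real.exp_le_exp.2 (le_of_eq ?_))
  rw [add_sub_cancel]
  unfold breg
  ring

/-- Chernoff bound for the upper tail of a sum. -/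
lemma measure_le_sum_le (hm : m ≠ 0) (hθ : θ ∈ params m) (hψ : ψ ∈ params m) (hle : θ ≤ ψ)
    (F : Finset ι) :
    P.real {ω | F.card * deriv (cgf id m) ψ ≤ ∑ i ∈ F, Z i ω}
      ≤ Real.exp (-(F.card * breg m ψ θ)) := by
  have hs : θ + (ψ - θ) ∈ params m := by simpa using hψ
  have := measure_ge_le_exp_cgf (μ := P) (X := ∑ i ∈ F, Z i) (t := ψ - θ)
    (F.card * deriv (cgf id m) ψ) (by linarith) (hZ.integrable_exp_mul_sum hθ hs F)
  rw [hZ.cgf_sum_eq hm hθ hs] at this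
  simp only [Finset.sum_apply] at this
  refine this.trans (Real.exp_le_exp.2 (le_of_eq ?_))
  rw [add_sub_cancel]
  unfold breg
  ring

lemma mem_interior_integrableExpSet_sum (hθ : θ ∈ params m) (hψ : ψ ∈ params m) (F : Finset ι) :
    ψ - θ ∈ interior (integrableExpSet (∑ i ∈ F, Z i) P) := by
  have hopen : IsOpen ((fun s => θ + s) ⁻¹' params m) :=
    isOpen_params.preimage (by fun_prop)
  refine mem_interior.2 ⟨(fun s => θ + s) ⁻¹' params m, fun s hs => hZ.integrable_exp_mul_sum hθ hs F, hopen, ?_⟩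
  rw [mem_preimage, add_sub_cancel]
  exact hψ

omit [IsProbabilityMeasure P] in
lemma deriv_cgf_sum_eventuallyEq (hm : m ≠ 0) (hθ : θ ∈ params m) (hψ : ψ ∈ params m)
    (F : Finset ι) :
    deriv (cgf (∑ i ∈ F, Z i) P) =ᶠ[𝓝 (ψ - θ)]
      fun s => F.card * deriv (cgf id m) (θ + s) := by
  have hopen : IsOpen ((fun s => θ + s) ⁻¹' params m) :=
    isOpen_params.preimage (by fun_prop)
  have hmem : (fun s => θ + s) ⁻¹' params m ∈ 𝓝 (ψ - θ) := hopen.mem_nhds (by simpa using hψ)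
  filter_upwards [hmem] with s hs
  have hev : cgf (∑ i ∈ F, Z i) P =ᶠ[𝓝 s]
      fun s => F.card * (cgf id m (θ + s) - cgf id m θ) := by
    filter_upwards [hopen.mem_nhds hs] with s' hs' using hZ.cgf_sum_eq hm hθ hs' F
  rw [hev.deriv_eq]
  have hd : HasDerivAt (fun s => cgf id m (θ + s)) (deriv (cgf id m) (θ + s)) s :=
    HasDerivAt.comp_const_add θ s (hasDerivAt_cgf hs)
  exact ((hd.sub_const _).const_mul _).deriv

/-- Lower bound for the probability of a large deviation of a sum, by change of measure. -/
lemma exists_le_measure_sum_lt (hm : m ≠ 0) (hθ : θ ∈ params m) (hφ : φ ∈ params m)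
    {c : ℝ} (hc : deriv (cgf id m) φ < c) {ε : ℝ} (hε : 0 < ε) :
    ∃ N : ℕ, ∀ F : Finset ι, N ≤ F.card →
      1 / 2 * Real.exp (-(F.card * (breg m φ θ + ε))) ≤ P.real {ω | ∑ i ∈ F, Z i ω < F.card * c} := by
  set t := φ - θ with ht
  set V := deriv (deriv (cgf id m)) φ with hV
  -- The window of half-width `r` per sample stays below `c` and costs at most `ε` per sample in the
  -- likelihood ratio; `N` below makes Chebyshev's bound at most 1/2.
  set r := min (c - deriv (cgf id m) φ) (ε / (|t| + 1)) with hr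
  have hr0 : 0 < r := lt_min (by linarith) (by positivity)
  have htr : |t| * r ≤ ε := by
    have h1 : r ≤ ε / (|t| + 1) := min_le_right _ _
    rw [le_div_iff₀ (by positivity)] at h1
    nlinarith [abs_nonneg t]
  obtain ⟨N, hN⟩ := exists_nat_ge (max (2 * V / r ^ 2) 1)
  refine ⟨N, fun F hF => ?_⟩
  set S := ∑ i ∈ F, Z i with hS
  set n := F.card with hn
  have hnN : max (2 * V / r ^ 2) 1 ≤ (n : ℝ) := hN.trans (by exact_mod_cast hF)
  have hint := hZ.mem_interior_integrableExpSet_sum hθ hφ F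
  have hexp : Integrable (fun ω => Real.exp (t * S ω)) P :=
    interior_subset (s := integrableExpSet S P) hint
  have hderiv := hZ.deriv_cgf_sum_eventuallyEq hm hθ hφ F
  set Q := P.tilted (fun ω => t * S ω) with hQ
  have hQprob : IsProbabilityMeasure Q := isProbabilityMeasure_tilted hexp
  have hmean : Q[S] = n * deriv (cgf id m) φ := by
    rw [hQ, integral_tilted_mul_self hint, hderiv.eq_of_nhds, add_sub_cancel]
  have hvar : Var[S; Q] = n * V := by
    rw [hQ, variance_tilted_mul hint, iteratedDeriv_succ, iteratedDeriv_one, hderiv.deriv_eq]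
    have hφ' : HasDerivAt (deriv (cgf id m)) V (θ + (φ - θ)) := by
      rw [add_sub_cancel]
      exact (differentiableAt_deriv_cgf hφ).hasDerivAt
    exact ((HasDerivAt.comp_const_add θ (φ - θ) hφ').const_mul _).deriv
  have hL2 : MemLp S 2 Q := by exact_mod_cast memLp_tilted_mul hint 2
  have hSm : Measurable S := by
    have hS' : S = fun ω => ∑ i ∈ F, Z i ω := by ext ω; rw [hS, Finset.sum_apply]
    rw [hS']
    exact Finset.measurable_sum _ fun i _ => hZ.measurable i
  set G := {ω | |S ω - n * deriv (cgf id m) φ| < n * r} with hG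
  have hGm : MeasurableSet G := measurableSet_lt (by fun_prop) (by fun_prop)
  have hn0 : (0 : ℝ) < n := one_pos.trans_le ((le_max_right _ _).trans hnN)
  have hQG : 1 / 2 ≤ Q.real G := by
    have hcheb := meas_ge_le_variance_div_sq hL2 (c := n * r) (by positivity)
    rw [hmean, hvar] at hcheb
    have hcompl : {ω | n * r ≤ |S ω - n * deriv (cgf id m) φ|} = Gᶜ := by
      ext ω; simp [hG]
    rw [hcompl] at hcheb
    have h2 : n * V / (n * r) ^ 2 ≤ 1 / 2 := by
      have h3 : 2 * V / r ^ 2 ≤ n := (le_max_left _ _).trans hnN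
      rw [div_le_iff₀ (by positivity)] at h3 ⊢
      nlinarith
    have h3 : Q.real Gᶜ ≤ 1 / 2 :=
      (ENNReal.toReal_le_of_le_ofReal (by norm_num) (hcheb.trans (ENNReal.ofReal_le_ofReal h2)))
    rw [probReal_compl_eq_one_sub hGm] at h3
    linarith
  have hQP : Q.real G ≤ Real.exp (n * (breg m φ θ + ε)) * P.real G := by
    have hs : θ + t ∈ params m := by rw [ht, add_sub_cancel]; exact hφ
    have h0 := tilted_mul_apply_eq_ofReal_integral_cgf' (μ := P) (X := S) (t := t) hGm hexp
    rw [← hQ] at h0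
    have h1 : Q.real G = ∫ ω in G, Real.exp (t * S ω - cgf S P t) ∂P := by
      rw [measureReal_def, h0, ENNReal.toReal_ofReal]
      exact integral_nonneg fun _ => (Real.exp_pos _).le
    rw [h1]
    calc ∫ ω in G, Real.exp (t * S ω - cgf S P t) ∂P
        ≤ ∫ _ in G, Real.exp (n * (breg m φ θ + ε)) ∂P := by
          refine setIntegral_mono_on ?_ (integrable_const _).integrableOn hGm fun ω hω => ?_
          · simp only [Real.exp_sub]
            exact (hexp.div_const _).integrableOn
          · apply Real.exp_le_exp.2
            rw [hS, hZ.cgf_sum_eq hm hθ hs F, ← hS, ← hn]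
            have h2 : t * (S ω - n * deriv (cgf id m) φ) ≤ |t| * (n * r) := by
              refine (le_abs_self _).trans ?_
              rw [abs_mul]
              exact mul_le_mul_of_nonneg_left (le_of_lt hω) (abs_nonneg _)
            have h3 : |t| * (n * r) ≤ n * ε := by nlinarith
            have h4 : θ + t = φ := by rw [ht]; ring
            rw [h4]
            unfold breg
            rw [ht] at h2 h3 ⊢
            linarith
      _ = Real.exp (n * (breg m φ θ + ε)) * P.real G := by
          rw [setIntegral_const, smul_eq_mul, mul_comm]
  have hGsub : P.real G ≤ P.real {ω | ∑ i ∈ F, Z i ω < n * c} := by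
    refine measureReal_mono fun ω hω => ?_
    have h1 := (abs_lt.1 (show |S ω - n * deriv (cgf id m) φ| < n * r from hω)).2
    have h2 : n * r ≤ n * (c - deriv (cgf id m) φ) :=
      mul_le_mul_of_nonneg_left (min_le_left _ _) hn0.le
    have h3 : S ω = ∑ i ∈ F, Z i ω := by rw [hS, Finset.sum_apply]
    rw [mem_ofPred_eq, ← h3]
    linarith
  refine le_trans ?_ hGsub
  have h5 := hQG.trans hQP
  rw [Real.exp_neg, ← div_eq_mul_inv, div_le_iff₀ (Real.exp_pos _)]
  linarith

end IsTiltedSample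

/-- With positive probability, uniformly in the horizon, all sample means stay above a level that
is smaller than the mean. -/
lemma IsTiltedSample.exists_pos_le_measure_forall {Ω : Type*} [MeasurableSpace Ω] {P : Measure Ω}
    [IsProbabilityMeasure P] {Z : ℕ → Ω → ℝ} (hZ : IsTiltedSample P m θ Z) (hm : m ≠ 0)
    (hM : StrictMonoOn (deriv (cgf id m)) (params m))
    (hθ : θ ∈ params m) (hφ : φ ∈ params m) (hlt : φ < θ) :
    ∃ p : ℝ, 0 < p ∧ ∀ T : ℕ, p ≤ P.real {ω | ∀ k, 1 ≤ k → k ≤ T →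
      k * deriv (cgf id m) φ ≤ ∑ i ∈ Finset.range k, Z i ω} := by
  have hMlt := hM hφ hθ hlt
  set δ := deriv (cgf id m) θ - deriv (cgf id m) φ with hδ
  have hδ0 : 0 < δ := by linarith
  set d := breg m φ θ with hd
  have hd0 : 0 < d := breg_pos hM hφ hθ hlt.ne
  have hq1 : Real.exp (-d) < 1 := by rw [Real.exp_lt_one_iff]; linarith
  set q := Real.exp (-d) with hq
  have hq0 : 0 < q := Real.exp_pos _
  set a := (θ - φ) * δ with ha
  have ha0 : 0 < a := mul_pos (by linarith) hδ0
  have htend : Tendsto (fun M : ℕ => Real.exp (-(a * M)) * (1 - q)⁻¹) atTop (𝓝 (0 * (1 - q)⁻¹)) := by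
    refine Tendsto.mul_const _ ?_
    refine Real.tendsto_exp_neg_atTop_nhds_zero.comp ?_
    exact tendsto_natCast_atTop_atTop.const_mul_atTop ha0
  rw [zero_mul] at htend
  obtain ⟨M, hMle⟩ := (htend.eventually (eventually_lt_nhds (show (0 : ℝ) < 1 / 2 by norm_num))).exists
  -- On `A` the first `M` samples build up a lead of `M * δ` over the level. Losing it later is the
  -- event `B k` below, independent of `A`; `M` was chosen so that these events have total
  -- probability below 1/2.
  set A : Set Ω := {ω | ∀ i < M, deriv (cgf id m) θ ≤ Z i ω} with hA
  have hAm : MeasurableSet A := by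
    have : A = ⋂ i : ℕ, ⋂ _ : i < M, {ω | deriv (cgf id m) θ ≤ Z i ω} := by
      ext ω; simp [hA]
    rw [this]
    exact MeasurableSet.iInter fun i => MeasurableSet.iInter fun _ =>
      measurableSet_le measurable_const (hZ.measurable i)
  have hone : ∀ i, 0 < P.real (Z i ⁻¹' Ici (deriv (cgf id m) θ)) := by
    intro i
    have := isProbabilityMeasure_tilted_id hm hθ
    have h1 := measure_integral_le_pos (integrable_id_tilted hm hθ)
    rw [integral_id_tilted hθ, ← hZ.law i] at h1
    have h2 : P (Z i ⁻¹' Ici (deriv (cgf id m) θ)) ≠ 0 := by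
      rw [← Measure.map_apply (hZ.measurable i) measurableSet_Ici]
      exact h1.ne'
    exact ENNReal.toReal_pos h2 (measure_ne_top _ _)
  have hAprod : P.real A = ∏ i ∈ Finset.range M, P.real (Z i ⁻¹' Ici (deriv (cgf id m) θ)) := by
    have h1 := hZ.indep.measure_inter_preimage_eq_mul (Finset.range M)
      (sets := fun _ => Ici (deriv (cgf id m) θ)) (fun i _ => measurableSet_Ici)
    have h2 : A = ⋂ i ∈ Finset.range M, Z i ⁻¹' Ici (deriv (cgf id m) θ) := by
      ext ω; simp [hA]
    rw [h2, measureReal_def, h1, ENNReal.toReal_prod]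
    rfl
  have hApos : 0 < P.real A := by
    rw [hAprod]
    exact Finset.prod_pos fun i _ => hone i
  set B : ℕ → Set Ω := fun k => {ω | ∑ i ∈ Finset.Ico M (M + k), Z i ω ≤
    k * deriv (cgf id m) φ - M * δ} with hB
  have hBle : ∀ k, P.real (B k) ≤ Real.exp (-(a * M)) * q ^ k := by
    intro k
    have := hZ.measure_sum_le_le hm hθ hφ hlt.le (Finset.Ico M (M + k)) (M * δ)
    rw [Nat.card_Ico, Nat.add_sub_cancel_left] at this
    refine this.trans (le_of_eq ?_)
    rw [hq, ← Real.exp_nat_mul, ← Real.exp_add]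
    congr 1
    rw [ha]; ring
  have hBm : ∀ k, MeasurableSet (B k) := fun k =>
    measurableSet_le (Finset.measurable_sum _ fun i _ => hZ.measurable i) measurable_const
  have hAB : ∀ k, P.real (A ∩ B k) = P.real A * P.real (B k) := by
    intro k
    have hdisj : Disjoint (Finset.range M) (Finset.Ico M (M + k)) := by
      rw [Finset.disjoint_left]
      intro i hi hi'
      rw [Finset.mem_range] at hi
      rw [Finset.mem_Ico] at hi'
      omega
    have hind := hZ.indep.indepFun_finset _ _ hdisj hZ.measurable
    have h1 := hind.measure_inter_preimage_eq_mul
      {v | ∀ i, deriv (cgf id m) θ ≤ v i}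
      {v | ∑ i, v i ≤ k * deriv (cgf id m) φ - M * δ}
      (by
        have : {v : Finset.range M → ℝ | ∀ i, deriv (cgf id m) θ ≤ v i}
            = ⋂ i, {v | deriv (cgf id m) θ ≤ v i} := by ext v; simp
        rw [this]
        exact MeasurableSet.iInter fun i => measurableSet_le measurable_const (by fun_prop))
      (measurableSet_le (by fun_prop) measurable_const)
    have e1 : (fun ω (i : Finset.range M) => Z i ω) ⁻¹' {v | ∀ i, deriv (cgf id m) θ ≤ v i} = A := by
      ext ω; simp [hA]
    have e2 : (fun ω (i : Finset.Ico M (M + k)) => Z i ω) ⁻¹'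
        {v | ∑ i, v i ≤ k * deriv (cgf id m) φ - M * δ} = B k := by
      ext ω
      simp only [hB, mem_preimage, mem_ofPred_eq]
      rw [Finset.sum_coe_sort (Finset.Ico M (M + k)) (fun i => Z i ω)]
    rw [e1, e2] at h1
    rw [measureReal_def, h1, ENNReal.toReal_mul]
    rfl
  refine ⟨P.real A / 2, by positivity, fun T => ?_⟩
  have hsub : A \ (⋃ k ∈ Finset.range (T + 1), A ∩ B k) ⊆ {ω | ∀ k, 1 ≤ k → k ≤ T →
      k * deriv (cgf id m) φ ≤ ∑ i ∈ Finset.range k, Z i ω} := by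
    rintro ω ⟨hωA, hω⟩ k hk1 hkT
    rcases le_or_gt k M with hkM | hkM
    · have h1 : ∑ i ∈ Finset.range k, deriv (cgf id m) θ ≤ ∑ i ∈ Finset.range k, Z i ω :=
        Finset.sum_le_sum fun i hi => hωA i ((Finset.mem_range.1 hi).trans_le hkM)
      rw [Finset.sum_const, Finset.card_range, nsmul_eq_mul] at h1
      have h2 : (k : ℝ) * deriv (cgf id m) φ ≤ k * deriv (cgf id m) θ := by gcongr
      linarith
    · obtain ⟨j, rfl⟩ := Nat.exists_eq_add_of_le hkM.le
      have h1 : ∑ i ∈ Finset.range M, deriv (cgf id m) θ ≤ ∑ i ∈ Finset.range M, Z i ω :=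
        Finset.sum_le_sum fun i hi => hωA i (Finset.mem_range.1 hi)
      rw [Finset.sum_const, Finset.card_range, nsmul_eq_mul] at h1
      have h2 : ω ∉ B j := fun hB => hω (by
        simp only [mem_iUnion]
        exact ⟨j, Finset.mem_range.2 (by omega), hωA, hB⟩)
      simp only [hB, mem_ofPred_eq, not_le] at h2
      rw [← Finset.sum_range_add_sum_Ico _ (Nat.le_add_right M j)]
      push_cast
      rw [hδ] at h2
      linarith
  refine le_trans ?_ (measureReal_mono hsub)
  have hU : P.real (⋃ k ∈ Finset.range (T + 1), A ∩ B k) ≤ P.real A / 2 := by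
    refine (measureReal_biUnion_finset_le _ _).trans ?_
    calc ∑ k ∈ Finset.range (T + 1), P.real (A ∩ B k)
        ≤ ∑ k ∈ Finset.range (T + 1), P.real A * (Real.exp (-(a * M)) * q ^ k) := by
          refine Finset.sum_le_sum fun k _ => ?_
          rw [hAB]
          exact mul_le_mul_of_nonneg_left (hBle k) measureReal_nonneg
      _ = P.real A * (Real.exp (-(a * M)) * ∑ k ∈ Finset.range (T + 1), q ^ k) := by
          rw [← Finset.mul_sum, ← Finset.mul_sum]
      _ ≤ P.real A * (Real.exp (-(a * M)) * (1 - q)⁻¹) := by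
          gcongr
          exact sum_le_hasSum _ (fun i _ => by positivity) (hasSum_geometric_of_lt_one hq0.le hq1)
      _ ≤ P.real A / 2 := by
          rw [div_eq_mul_one_div]
          exact mul_le_mul_of_nonneg_left hMle.le measureReal_nonneg
  have hUm : MeasurableSet (⋃ k ∈ Finset.range (T + 1), A ∩ B k) :=
    Finset.measurableSet_biUnion _ fun k _ => hAm.inter (hBm k)
  have hUA : (⋃ k ∈ Finset.range (T + 1), A ∩ B k) ⊆ A :=
    iUnion₂_subset fun k _ => inter_subset_left
  rw [measureReal_sdiff hUA hUm]
  linarith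

end ExpTilt

/-! ### Pathwise analysis of a run -/

namespace ExpFamily

open Set ExpTilt

section Plays

variable (a : ℕ → Fin 2)

lemma plays_succ (k : Fin 2) (t : ℕ) :
    plays a k (t + 1) = plays a k t + if a (t + 1) = k then 1 else 0 := by
  unfold plays
  rw [← Finset.insert_Icc_right_eq_Icc_add_one (by omega), Finset.filter_insert]
  split_ifs with h
  · rw [Finset.card_insert_of_notMem (by simp)]
  · simp

lemma plays_mono (k : Fin 2) : Monotone (plays a k) :=
  monotone_nat_of_le_succ fun t => by rw [plays_succ]; omega

lemma plays_zero_add_plays_one (t : ℕ) : plays a 0 t + plays a 1 t = t := by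
  induction t with
  | zero => simp [plays]
  | succ t ih =>
    have hb : ∀ b : Fin 2, ((if b = 0 then 1 else 0) + if b = 1 then 1 else 0) = 1 := by decide
    have := hb (a (t + 1))
    rw [plays_succ, plays_succ]
    omega

/-- An arm that has been played more than `M` times was played at a moment when it had been played
exactly `M` times. -/
lemma exists_plays_eq {k : Fin 2} {M T : ℕ} (h2 : plays a k 2 ≤ M) (hT : M < plays a k T) :
    ∃ t, 2 ≤ t ∧ t < T ∧ a (t + 1) = k ∧ plays a k t = M := by
  have hex : ∃ s, M < plays a k s := ⟨T, hT⟩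
  classical
  set s := Nat.find hex with hs
  have hsM : M < plays a k s := Nat.find_spec hex
  have h2s : 2 < s := by
    by_contra hc
    exact absurd (hsM.trans_le (plays_mono a k (not_lt.1 hc))) (not_lt.2 h2)
  obtain ⟨t, ht⟩ : ∃ t, s = t + 1 := ⟨s - 1, by omega⟩
  have htM : plays a k t ≤ M := not_lt.1 (Nat.find_min hex (by omega))
  have hsT : s ≤ T := Nat.find_min' hex hT
  rw [ht, plays_succ] at hsM
  refine ⟨t, by omega, by omega, ?_, ?_⟩
  · by_contra hc
    rw [if_neg hc] at hsM
    omega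
  · split_ifs at hsM <;> omega

end Plays

variable {ρ : Measure ℝ} {h : ℝ → ℝ≥0}

section Steep

variable (hh : Measurable h) (hsteep : IsSteep ρ h) (hnt : (meanSet ρ h).Nontrivial)
include hh hsteep hnt

lemma sampleMean_mem_closure {r : ℕ → ℝ} (hr : ∀ i, r i ∈ closure (meanSet ρ h)) {n : ℕ}
    (hn : 1 ≤ n) : sampleMean r n ∈ closure (meanSet ρ h) := by
  have hconv : Convex ℝ (closure (meanSet ρ h)) :=
    (ordConnected_meanSet hh hsteep (carrier_ne_zero hh hnt)).convex.closure
  have hn0 : (n : ℝ) ≠ 0 := by positivity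
  have := hconv.sum_mem (t := Finset.range n) (w := fun _ => (n : ℝ)⁻¹) (z := r)
    (fun _ _ => by positivity) (by simp [hn0]) (fun i _ => hr i)
  rw [← Finset.smul_sum, smul_eq_mul, inv_mul_eq_div] at this
  exact this

/-- If the suboptimal arm is played more than `M` times although its sample mean after `M` plays is
not too large, then a sample mean of the optimal arm is exceptionally low. -/
lemma IsKLUCBRun.exists_low_mean {r : Fin 2 → ℕ → ℝ} {a : ℕ → Fin 2}
    (hrun : IsKLUCBRun ρ h r a) (hr : ∀ k i, r k i ∈ closure (meanSet ρ h))
    {ψ φ χ : ℝ} (hψ : ψ ∈ params (carrier ρ h)) (hφ : φ ∈ params (carrier ρ h))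
    (hχ : χ ∈ params (carrier ρ h)) (hψφ : ψ < φ) (hφχ : φ < χ) {M T : ℕ} (hM : 1 ≤ M)
    (hlog : Real.log T / M < breg (carrier ρ h) ψ φ)
    (hmean : sampleMean (r 1) M < mean ρ h ψ) (hT : M < plays a 1 T) :
    ∃ n, 1 ≤ n ∧ n ≤ T ∧ ∃ θ ∈ params (carrier ρ h), θ < χ ∧
      Real.log M / n < breg (carrier ρ h) θ χ ∧ sampleMean (r 0) n ≤ mean ρ h θ := by
  obtain ⟨t, ht2, htT, hat, hplays⟩ := exists_plays_eq a (by rw [hrun.init]; exact hM) hT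
  have hpos := breg_pos (strictMonoOn_deriv hh hsteep hnt) hψ hφ hψφ.ne
  have hgreedy := hrun.greedy t ht2 0
  rw [hat, hplays] at hgreedy
  have hlogt : Real.log t / M < breg (carrier ρ h) ψ φ := by
    refine lt_of_le_of_lt ?_ hlog
    gcongr
  have hidx := hgreedy.trans
    (klucbIndex_le hh hsteep hnt hψ hφ hψφ.le hmean hlogt hpos)
  have hn1 : 1 ≤ plays a 0 t := (hrun.init 0).ge.trans (plays_mono a 0 ht2)
  have hsum := plays_zero_add_plays_one a t
  obtain ⟨θ, hθ, hle, hlt, hb⟩ := exists_of_klucbIndex_le hh hsteep hnt hφ hχ hφχ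
    (sampleMean_mem_closure hh hsteep hnt (hr 0) hn1) hidx
  refine ⟨plays a 0 t, hn1, by omega, θ, hθ, hlt, lt_of_le_of_lt ?_ hb, hle⟩
  -- Replacing log t by the smaller log M frees the event from the random time `t`, so that a union
  -- over `n` suffices.
  have hMt : M ≤ t := by omega
  gcongr

/-- If a sample mean of the optimal arm is low while all sample means of the other arm are not,
then the optimal arm is abandoned for a long time. -/
lemma IsKLUCBRun.plays_zero_le {r : Fin 2 → ℕ → ℝ} {a : ℕ → Fin 2}
    (hrun : IsKLUCBRun ρ h r a) (hr : ∀ k i, r k i ∈ closure (meanSet ρ h))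
    {ψ φ χ : ℝ} (hψ : ψ ∈ params (carrier ρ h)) (hφ : φ ∈ params (carrier ρ h))
    (hχ : χ ∈ params (carrier ρ h)) (hψφ : ψ < φ) (hφχ : φ < χ) {n T : ℕ} (hn : 1 ≤ n)
    (hlog : Real.log T / n < breg (carrier ρ h) ψ φ)
    (hlow : sampleMean (r 0) n < mean ρ h ψ)
    (hhigh : ∀ k, 1 ≤ k → k ≤ T → mean ρ h χ ≤ sampleMean (r 1) k) (hT : 2 ≤ T) :
    plays a 0 T ≤ n := by
  have hpos := breg_pos (strictMonoOn_deriv hh hsteep hnt) hψ hφ hψφ.ne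
  have key : ∀ t, 2 ≤ t → t ≤ T → plays a 0 t ≤ n := by
    intro t ht
    induction t, ht using Nat.le_induction with
    | base => intro _; rw [hrun.init]; exact hn
    | succ t ht ih =>
      intro htT
      have hle := ih (by omega)
      rw [plays_succ]
      rcases hle.lt_or_eq with hlt | heq
      · split_ifs <;> omega
      -- With exactly `n` plays the optimal arm has index at most `mean ρ h φ < mean ρ h χ`, hence
      -- below the sample mean, and so below the index, of the other arm.
      · rw [if_neg]
        · omega
        · intro hat
          have hgreedy := hrun.greedy t ht 1
          rw [hat, heq] at hgreedy
          have hlogt : Real.log t / n < breg (carrier ρ h) ψ φ := by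
            refine lt_of_le_of_lt ?_ hlog
            have htT' : t ≤ T := by omega
            gcongr
          have hk1 : 1 ≤ plays a 1 t := (hrun.init 1).ge.trans (plays_mono a 1 ht)
          have hsum := plays_zero_add_plays_one a t
          have h1 := klucbIndex_le hh hsteep hnt hψ hφ hψφ.le hlow hlogt hpos
          have h2 := le_klucbIndex hh hsteep hnt
            (sampleMean_mem_closure hh hsteep hnt (hr 1) hk1) (plays a 1 t) t
          have h3 := EReal.coe_le_coe_iff.1 (h2.trans (hgreedy.trans h1))
          have h4 := hhigh _ hk1 (by omega)
          have h5 := mean_strictMonoOn hh hsteep hnt hφ hχ hφχ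
          linarith
  exact key T hT le_rfl

end Steep

end ExpFamily

/-! ### Probability bounds for the number of plays -/

namespace ExpFamily

open Set ExpTilt

variable {ρ : Measure ℝ} {h : ℝ → ℝ≥0}

/-- The reward sequences of the two arms are independent. -/
lemma measure_inter_sums_eq {Ω : Type*} [MeasurableSpace Ω] {P : Measure Ω}
    {X : Fin 2 → ℕ → Ω → ℝ} (hmeas : ∀ k i, Measurable (X k i))
    (hindep : iIndepFun (fun p : Fin 2 × ℕ => X p.1 p.2) P) (n T : ℕ) (u v : ℝ) :
    P.real ({ω | ∑ i ∈ Finset.range n, X 0 i ω < u} ∩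
        {ω | ∀ k, 1 ≤ k → k ≤ T → k * v ≤ ∑ i ∈ Finset.range k, X 1 i ω})
      = P.real {ω | ∑ i ∈ Finset.range n, X 0 i ω < u} *
        P.real {ω | ∀ k, 1 ≤ k → k ≤ T → k * v ≤ ∑ i ∈ Finset.range k, X 1 i ω} := by
  set F : Finset (Fin 2 × ℕ) := {0} ×ˢ Finset.range n with hF
  set G : Finset (Fin 2 × ℕ) := {1} ×ˢ Finset.range T with hG
  have hdisj : Disjoint F G := by
    rw [Finset.disjoint_left]
    rintro ⟨k, i⟩ hk hk'
    simp only [hF, hG, Finset.mem_product, Finset.mem_singleton] at hk hk'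
    exact absurd (hk.1.symm.trans hk'.1) (by decide)
  have hind := hindep.indepFun_finset F G hdisj fun p => hmeas p.1 p.2
  have hm2 : MeasurableSet {w : G → ℝ | ∀ k : ℕ, 1 ≤ k → k ≤ T →
      k * v ≤ ∑ i : G, if (i : Fin 2 × ℕ).2 < k then w i else 0} := by
    have : {w : G → ℝ | ∀ k : ℕ, 1 ≤ k → k ≤ T →
        k * v ≤ ∑ i : G, if (i : Fin 2 × ℕ).2 < k then w i else 0} =
        ⋂ k : ℕ, ⋂ _ : 1 ≤ k, ⋂ _ : k ≤ T,
          {w | k * v ≤ ∑ i : G, if (i : Fin 2 × ℕ).2 < k then w i else 0} := by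
      ext w; simp
    rw [this]
    refine MeasurableSet.iInter fun k => MeasurableSet.iInter fun _ =>
      MeasurableSet.iInter fun _ => measurableSet_le measurable_const
        (Finset.measurable_sum _ fun i _ => ?_)
    split_ifs
    · fun_prop
    · fun_prop
  have := hind.measure_inter_preimage_eq_mul {w | ∑ i, w i < u}
    {w | ∀ k : ℕ, 1 ≤ k → k ≤ T → k * v ≤ ∑ i : G, if (i : Fin 2 × ℕ).2 < k then w i else 0}
    (measurableSet_lt (by fun_prop) measurable_const) hm2
  have e1 : (fun ω (i : F) => X (i : Fin 2 × ℕ).1 (i : Fin 2 × ℕ).2 ω) ⁻¹' {w | ∑ i, w i < u}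
      = {ω | ∑ i ∈ Finset.range n, X 0 i ω < u} := by
    ext ω
    simp only [mem_preimage, mem_ofPred_eq]
    rw [Finset.sum_coe_sort F (fun i => X i.1 i.2 ω), hF, Finset.sum_product,
      Finset.sum_singleton]
  have e2 : (fun ω (i : G) => X (i : Fin 2 × ℕ).1 (i : Fin 2 × ℕ).2 ω) ⁻¹'
      {w | ∀ k : ℕ, 1 ≤ k → k ≤ T → k * v ≤ ∑ i : G, if (i : Fin 2 × ℕ).2 < k then w i else 0}
      = {ω | ∀ k, 1 ≤ k → k ≤ T → k * v ≤ ∑ i ∈ Finset.range k, X 1 i ω} := by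
    ext ω
    simp only [mem_preimage, mem_ofPred_eq]
    refine forall_congr' fun k => forall_congr' fun _ => forall_congr' fun hkT => ?_
    rw [Finset.sum_coe_sort G (fun i => if i.2 < k then X i.1 i.2 ω else 0), hG,
      Finset.sum_product, Finset.sum_singleton, ← Finset.sum_filter]
    have : (Finset.range T).filter (fun i => i < k) = Finset.range k := by
      ext i
      simp only [Finset.mem_filter, Finset.mem_range]
      omega
    rw [this]
  rw [e1, e2] at this
  simp only [measureReal_def, this, ENNReal.toReal_mul]

section Steep

variable (hh : Measurable h) (hsteep : IsSteep ρ h) (hnt : (meanSet ρ h).Nontrivial)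
include hh hsteep hnt

variable {Ω : Type*} [MeasurableSpace Ω] {P : Measure Ω} [IsProbabilityMeasure P]
  {θ₁ θ₂ : ℝ}

/-- The probability that the sample mean of the optimal arm is so low that its index after `n` plays
falls below the level `χ` at time `M`. -/
lemma measure_low_mean_le (h1 : θ₁ ∈ params (carrier ρ h)) {Z : ℕ → Ω → ℝ}
    (hZ : IsTiltedSample P (carrier ρ h) θ₁ Z) {χ : ℝ} (hχ : χ ∈ params (carrier ρ h))
    (hχ1 : χ < θ₁) {c : ℝ} (hc : 0 < c)
    (hle : ∀ θ ∈ params (carrier ρ h), θ < χ →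
      breg (carrier ρ h) θ χ ≤ c * breg (carrier ρ h) θ θ₁)
    {η : ℝ} (hη0 : 0 < η) (hη1 : η < 1) {M n : ℕ} (hn : 1 ≤ n) :
    P.real {ω | ∃ θ ∈ params (carrier ρ h), θ < χ ∧
        Real.log M / n < breg (carrier ρ h) θ χ ∧ sampleMean (fun i => Z i ω) n ≤ mean ρ h θ}
      ≤ Real.exp (-((1 - η) / c * Real.log M))
        * Real.exp (-(η * breg (carrier ρ h) χ θ₁)) ^ n := by
  set m := carrier ρ h
  have hm : m ≠ 0 := carrier_ne_zero hh hnt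
  have hM := strictMonoOn_deriv hh hsteep hnt
  have hn0 : (0 : ℝ) < n := by exact_mod_cast hn
  set K : Set ℝ := {θ | θ ∈ params m ∧ θ < χ ∧ Real.log M / n < breg m θ χ} with hK
  rcases K.eq_empty_or_nonempty with hemp | ⟨θ₀, hθ₀⟩
  · have : {ω | ∃ θ ∈ params m, θ < χ ∧ Real.log M / n < breg m θ χ ∧
        sampleMean (fun i => Z i ω) n ≤ mean ρ h θ} = ∅ := by
      ext ω
      simp only [mem_ofPred_eq, mem_empty_iff_false, iff_false]
      rintro ⟨θ, hθ1, hθ2, hθ3, -⟩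
      have : θ ∈ K := ⟨hθ1, hθ2, hθ3⟩
      rw [hemp] at this
      exact this
    rw [this, measureReal_empty]
    positivity
  · have hbdd : BddAbove K := ⟨χ, fun θ hθ => hθ.2.1.le⟩
    -- The existential over `θ` collapses to the threshold `s`, to which one Chernoff bound applies;
    -- by continuity `s` still meets the level non-strictly.
    set s := sSup K with hs
    have hsχ : s ≤ χ := csSup_le ⟨θ₀, hθ₀⟩ fun θ hθ => hθ.2.1.le
    have hθ₀s : θ₀ ≤ s := le_csSup hbdd hθ₀
    have hsJ : s ∈ params m := ordConnected_params.out hθ₀.1 hχ ⟨hθ₀s, hsχ⟩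
    have hlevel : Real.log M / n ≤ breg m s χ := by
      by_contra hcon
      have hcont : ContinuousAt (fun θ => breg m θ χ) s :=
        ContinuousAt.comp (f := fun θ : ℝ => (θ, χ)) (g := fun p : ℝ × ℝ => breg m p.1 p.2)
          (continuousAt_breg hsJ hχ) (by fun_prop)
      have hev : ∀ᶠ θ in 𝓝 s, breg m θ χ < Real.log M / n :=
        hcont.eventually_lt continuousAt_const (not_le.1 hcon)
      have hfr := mem_closure_iff_frequently.1 (csSup_mem_closure ⟨θ₀, hθ₀⟩ hbdd)
      obtain ⟨θ, hθK, hθ⟩ := (hfr.and_eventually hev).exists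
      exact lt_asymm hθ hθK.2.2
    have hsub : {ω | ∃ θ ∈ params m, θ < χ ∧ Real.log M / n < breg m θ χ ∧
        sampleMean (fun i => Z i ω) n ≤ mean ρ h θ} ⊆
        {ω | ∑ i ∈ Finset.range n, Z i ω ≤
          (Finset.range n).card * deriv (cgf id m) s - 0} := by
      rintro ω ⟨θ, hθ1, hθ2, hθ3, hle⟩
      have h2 : θ ≤ s := le_csSup hbdd ⟨hθ1, hθ2, hθ3⟩
      have h3 := hM.monotoneOn hθ1 hsJ h2
      rw [mean_eq hh hm hθ1, sampleMean, div_le_iff₀ hn0] at hle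
      simp only [mem_ofPred_eq, Finset.card_range, sub_zero]
      nlinarith
    refine (measureReal_mono hsub).trans
      ((hZ.measure_sum_le_le hm h1 hsJ (hsχ.trans hχ1.le) _ 0).trans ?_)
    rw [← Real.exp_nat_mul, ← Real.exp_add]
    apply Real.exp_le_exp.2
    rw [Finset.card_range, mul_zero, sub_zero]
    have i1 : breg m s χ ≤ c * breg m s θ₁ := by
      rcases hsχ.lt_or_eq with hlt | heq
      · exact hle s hsJ hlt
      · rw [heq, breg_self]
        exact mul_nonneg hc.le (breg_nonneg hM hχ h1)
    have i2 : breg m χ θ₁ ≤ breg m s θ₁ := breg_anti_left hM hsJ hχ hsχ hχ1.le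
    have i3 : Real.log M / c ≤ n * breg m s θ₁ := by
      rw [div_le_iff₀ hn0] at hlevel
      rw [div_le_iff₀ hc]
      nlinarith
    -- The exponent is split: the share `1 - η` yields the power of `M`, the share `η` a factor
    -- geometric in `n`.
    have i4 : (1 - η) / c * Real.log M ≤ (1 - η) * (n * breg m s θ₁) := by
      rw [div_mul_eq_mul_div, mul_div_assoc]
      exact mul_le_mul_of_nonneg_left i3 (by linarith)
    have i5 : η * n * breg m χ θ₁ ≤ η * n * breg m s θ₁ := by gcongr
    linarith

variable {X : Fin 2 → ℕ → Ω → ℝ} {a : ℕ → Ω → Fin 2}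

/-- Either the suboptimal arm looks too good after `M` plays (event `U`), or the optimal arm looks
too bad after some `n` plays (event `V n`). The constants do not depend on the horizon, which enters
only through log T / M. -/
lemma exists_measure_plays_le (h1 : θ₁ ∈ params (carrier ρ h)) (h2 : θ₂ ∈ params (carrier ρ h))
    (h21 : θ₂ < θ₁) (hX0 : IsTiltedSample P (carrier ρ h) θ₁ (X 0))
    (hX1 : IsTiltedSample P (carrier ρ h) θ₂ (X 1))
    (hrun : ∀ᵐ ω ∂P, IsKLUCBRun ρ h (fun k i => X k i ω) (fun t => a t ω))
    (hsupp : ∀ᵐ ω ∂P, ∀ k i, X k i ω ∈ closure (meanSet ρ h))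
    {b : ℝ} (hb : b < tailExponent ρ h (mean ρ h θ₁) (mean ρ h θ₂)) :
    ∃ C d δ : ℝ, 0 ≤ C ∧ 0 < d ∧ 0 < δ ∧ ∀ M T : ℕ, 1 ≤ M → Real.log T / M < δ →
      P.real {ω | M < plays (fun t => a t ω) 1 T} ≤
        Real.exp (-(M * d)) + C * Real.exp (-(b * Real.log M)) := by
  set m := carrier ρ h
  have hm : m ≠ 0 := carrier_ne_zero hh hnt
  have hM := strictMonoOn_deriv hh hsteep hnt
  have hκ := one_le_tailExponent hh hsteep hnt h1 h2 h21
  set κ := tailExponent ρ h (mean ρ h θ₁) (mean ρ h θ₂) with hκdef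
  -- The attainable exponent tends to `κ` as `η` tends to 0.
  obtain ⟨η, ⟨hη, hη1⟩, hη0⟩ : ∃ η : ℝ, (b < (1 - η) / (1 / κ + η) ∧ η < 1) ∧ 0 < η := by
    have hcont : ContinuousAt (fun η : ℝ => (1 - η) / (1 / κ + η)) 0 := by
      refine ContinuousAt.div (by fun_prop) (by fun_prop) ?_
      have : 0 < 1 / κ := by positivity
      linarith
    have ev1 : ∀ᶠ η : ℝ in 𝓝 0, b < (1 - η) / (1 / κ + η) :=
      continuousAt_const.eventually_lt hcont (by simpa using hb)
    have ev2 : ∀ᶠ η : ℝ in 𝓝 0, η < 1 := eventually_lt_nhds one_pos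
    have ev : ∀ᶠ η : ℝ in 𝓝[>] 0, b < (1 - η) / (1 / κ + η) ∧ η < 1 :=
      nhdsWithin_le_nhds (ev1.and ev2)
    exact (ev.and self_mem_nhdsWithin).exists
  obtain ⟨χ, hχ, h2χ, hχ1, hle⟩ := exists_breg_le hh hsteep hnt h1 h2 h21 hη0
  have hc : 0 < 1 / κ + η := by positivity
  obtain ⟨ψ, φ, h2ψ, hψφ, hφχ⟩ : ∃ ψ φ, θ₂ < ψ ∧ ψ < φ ∧ φ < χ := by
    obtain ⟨ψ, hψ, hψ'⟩ := exists_between h2χ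
    obtain ⟨φ, hφ, hφ'⟩ := exists_between hψ'
    exact ⟨ψ, φ, hψ, hφ, hφ'⟩
  have hψ : ψ ∈ params m := ordConnected_params.out h2 hχ ⟨h2ψ.le, (hψφ.trans hφχ).le⟩
  have hφ : φ ∈ params m := ordConnected_params.out h2 hχ ⟨(h2ψ.trans hψφ).le, hφχ.le⟩
  set q := Real.exp (-(η * breg m χ θ₁)) with hq
  have hq0 : 0 < q := Real.exp_pos _
  have hq1 : q < 1 := by
    rw [hq, Real.exp_lt_one_iff, neg_lt_zero]
    exact mul_pos hη0 (breg_pos hM hχ h1 hχ1.ne)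
  refine ⟨(1 - q)⁻¹, breg m ψ θ₂, breg m ψ φ, inv_nonneg.2 (by linarith),
    breg_pos hM hψ h2 h2ψ.ne', breg_pos hM hψ hφ hψφ.ne, fun M T hM1 hlog => ?_⟩
  have hM0 : (0 : ℝ) < M := by exact_mod_cast hM1
  set U : Set Ω := {ω | (Finset.range M).card * deriv (cgf id m) ψ
    ≤ ∑ i ∈ Finset.range M, X 1 i ω} with hU
  set V : ℕ → Set Ω := fun n => {ω | ∃ θ ∈ params m, θ < χ ∧
    Real.log M / n < breg m θ χ ∧ sampleMean (fun i => X 0 i ω) n ≤ mean ρ h θ} with hV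
  have hsub : ({ω | M < plays (fun t => a t ω) 1 T} : Set Ω) ≤ᵐ[P]
      (U ∪ ⋃ n ∈ Finset.Icc 1 T, V n : Set Ω) := by
    filter_upwards [hrun, hsupp] with ω hω hω' hplays
    by_cases hωU : ω ∈ U
    · exact Or.inl hωU
    · right
      have hlt : sampleMean (fun i => X 1 i ω) M < mean ρ h ψ := by
        rw [mean_eq hh hm hψ, sampleMean, div_lt_iff₀ hM0]
        simp only [hU, mem_ofPred_eq, Finset.card_range, not_le] at hωU
        linarith
      obtain ⟨n, hn1, hnT, hex⟩ := hω.exists_low_mean hh hsteep hnt hω' hψ hφ hχ hψφ hφχ hM1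
        hlog hlt hplays
      exact mem_iUnion₂.2 ⟨n, Finset.mem_Icc.2 ⟨hn1, hnT⟩, hex⟩
  have hstep : P.real {ω | M < plays (fun t => a t ω) 1 T} ≤
      P.real (U ∪ ⋃ n ∈ Finset.Icc 1 T, V n) :=
    ENNReal.toReal_mono (measure_ne_top _ _) (measure_mono_ae hsub)
  refine hstep.trans ((measureReal_union_le _ _).trans (add_le_add ?_ ?_))
  · exact (hX1.measure_le_sum_le hm h2 hψ h2ψ.le (Finset.range M)).trans
      (by rw [Finset.card_range])
  · refine (measureReal_biUnion_finset_le _ _).trans ?_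
    have hlogM : 0 ≤ Real.log M := Real.log_nonneg (by exact_mod_cast hM1)
    calc ∑ n ∈ Finset.Icc 1 T, P.real (V n)
        ≤ ∑ n ∈ Finset.Icc 1 T, Real.exp (-(b * Real.log M)) * q ^ n := by
          refine Finset.sum_le_sum fun n hn => ?_
          refine (measure_low_mean_le hh hsteep hnt h1 hX0 hχ hχ1 hc hle hη0 hη1
            (Finset.mem_Icc.1 hn).1).trans ?_
          refine mul_le_mul_of_nonneg_right (Real.exp_le_exp.2 (neg_le_neg ?_)) (by positivity)
          exact mul_le_mul_of_nonneg_right hη.le hlogM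
      _ = (∑ n ∈ Finset.Icc 1 T, q ^ n) * Real.exp (-(b * Real.log M)) := by
          rw [← Finset.mul_sum, mul_comm]
      _ ≤ (1 - q)⁻¹ * Real.exp (-(b * Real.log M)) := by
          gcongr
          exact sum_le_hasSum _ (fun i _ => by positivity)
            (hasSum_geometric_of_lt_one hq0.le hq1)

/-- Bad initial rewards of the optimal arm, together with persistently normal rewards of the other
arm, lock the optimal arm out after about `D * Real.log t` plays. -/
lemma exists_le_measure_plays (h1 : θ₁ ∈ params (carrier ρ h)) (h2 : θ₂ ∈ params (carrier ρ h))
    (hX0 : IsTiltedSample P (carrier ρ h) θ₁ (X 0))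
    (hX1 : IsTiltedSample P (carrier ρ h) θ₂ (X 1))
    (hindep : iIndepFun (fun p : Fin 2 × ℕ => X p.1 p.2) P)
    (hrun : ∀ᵐ ω ∂P, IsKLUCBRun ρ h (fun k i => X k i ω) (fun t => a t ω))
    (hsupp : ∀ᵐ ω ∂P, ∀ k i, X k i ω ∈ closure (meanSet ρ h))
    {c : ℝ} (hc : tailExponent ρ h (mean ρ h θ₁) (mean ρ h θ₂) < c) :
    ∃ C D : ℝ, ∃ N : ℕ, 0 < C ∧ 0 < D ∧ ∀ t : ℕ, N ≤ t →
      C * Real.exp (-(c * Real.log t)) ≤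
        P.real {ω | (t : ℝ) - (D * Real.log t + 1) ≤ plays (fun t => a t ω) 1 t} := by
  set m := carrier ρ h
  have hm : m ≠ 0 := carrier_ne_zero hh hnt
  have hM := strictMonoOn_deriv hh hsteep hnt
  obtain ⟨θ, hθ, ψ, hψ, φ, hφ, χ, hχ, hθψ, hψφ, hφχ, hχ2, hratio⟩ :=
    exists_ratio_lt_of_slack hh hsteep hnt h1 h2 hc
  have hB := breg_pos hM hψ hφ hψφ.ne
  set B := breg m ψ φ with hBdef
  have hE := breg_nonneg hM hθ h1
  set ε := (c * B - breg m θ θ₁) / 2 with hεdef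
  have hε : 0 < ε := by
    rw [div_lt_iff₀ hB] at hratio
    rw [hεdef]
    linarith
  have hcB : breg m θ θ₁ + ε < c * B := by rw [hεdef] at hε ⊢; linarith
  obtain ⟨N, hN⟩ := hX0.exists_le_measure_sum_lt hm h1 hθ (hM hθ hψ hθψ) hε
  obtain ⟨p, hp, hpT⟩ := hX1.exists_pos_le_measure_forall hm hM h2 hχ hχ2
  have htend : Tendsto (fun t : ℕ => Real.log t / B) atTop atTop :=
    (Real.tendsto_log_atTop.comp tendsto_natCast_atTop_atTop).atTop_div_const hB
  obtain ⟨N', hN'⟩ := eventually_atTop.1 (htend.eventually (eventually_ge_atTop (N : ℝ)))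
  refine ⟨1 / 2 * Real.exp (-(c * B)) * p, 1 / B, max N' 2, by positivity, by positivity,
    fun t ht => ?_⟩
  have ht2 : 2 ≤ t := (le_max_right _ _).trans ht
  have htN := hN' t ((le_max_left _ _).trans ht)
  have hlogt : 0 ≤ Real.log t := Real.log_nonneg (by exact_mod_cast (by omega : 1 ≤ t))
  -- The least number of plays for which the exploration level `Real.log t / n` is strictly below
  -- `B`.
  set n := ⌊Real.log t / B⌋₊ + 1 with hn
  have hnlt : Real.log t / B < n := by rw [hn]; push_cast; exact Nat.lt_floor_add_one _
  have hnle : (n : ℝ) ≤ Real.log t / B + 1 := by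
    rw [hn]; push_cast
    linarith [Nat.floor_le (show 0 ≤ Real.log t / B by positivity)]
  have hn0 : (0 : ℝ) < n := by rw [hn]; positivity
  have hNn : N ≤ n := by exact_mod_cast (htN.trans hnlt.le)
  have hlow := hN (Finset.range n) (by rw [Finset.card_range]; exact hNn)
  rw [Finset.card_range] at hlow
  have hhigh := hpT t
  have hlogn : Real.log t / n < B := by
    rw [div_lt_iff₀ hB] at hnlt
    rw [div_lt_iff₀ hn0]
    linarith
  have hsub : ({ω | ∑ i ∈ Finset.range n, X 0 i ω < n * deriv (cgf id m) ψ} ∩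
      {ω | ∀ k, 1 ≤ k → k ≤ t → k * deriv (cgf id m) χ ≤ ∑ i ∈ Finset.range k, X 1 i ω} : Set Ω)
      ≤ᵐ[P] ({ω | (t : ℝ) - (1 / B * Real.log t + 1) ≤ plays (fun t => a t ω) 1 t} : Set Ω) := by
    filter_upwards [hrun, hsupp] with ω hω hω' hmem
    have hk := hω.plays_zero_le hh hsteep hnt hω' hψ hφ hχ hψφ hφχ (n := n) (T := t)
      (by omega) hlogn
      (by
        rw [mean_eq hh hm hψ, sampleMean, div_lt_iff₀ hn0]
        have h3 : ∑ i ∈ Finset.range n, X 0 i ω < n * deriv (cgf id m) ψ := hmem.1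
        linarith)
      (fun k hk1 hkt => by
        have hk0 : (0 : ℝ) < k := by exact_mod_cast hk1
        rw [mean_eq hh hm hχ, sampleMean, le_div_iff₀ hk0]
        have h3 : k * deriv (cgf id m) χ ≤ ∑ i ∈ Finset.range k, X 1 i ω := hmem.2 k hk1 hkt
        linarith) ht2
    have hsum := plays_zero_add_plays_one (fun t => a t ω) t
    have hsum' : (plays (fun t => a t ω) 0 t : ℝ) + plays (fun t => a t ω) 1 t = t := by
      exact_mod_cast hsum
    have hk' : (plays (fun t => a t ω) 0 t : ℝ) ≤ n := by exact_mod_cast hk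
    show (t : ℝ) - (1 / B * Real.log t + 1) ≤ plays (fun t => a t ω) 1 t
    rw [one_div, ← div_eq_inv_mul]
    linarith
  refine le_trans ?_ (ENNReal.toReal_mono (measure_ne_top _ _) (measure_mono_ae hsub))
  rw [← measureReal_def, measure_inter_sums_eq (fun k => by
    rcases Fin.exists_fin_two.1 ⟨k, rfl⟩ with h | h
    · exact h ▸ hX0.measurable
    · exact h ▸ hX1.measurable) hindep]
  calc 1 / 2 * Real.exp (-(c * B)) * p * Real.exp (-(c * Real.log t))
      = 1 / 2 * Real.exp (-((Real.log t / B + 1) * (c * B))) * p := by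
        have : -((Real.log t / B + 1) * (c * B)) = -(c * B) + -(c * Real.log t) := by
          field_simp
          ring
        rw [this, Real.exp_add]
        ring
    _ ≤ 1 / 2 * Real.exp (-(n * (breg m θ θ₁ + ε))) * p := by
        gcongr
    _ ≤ _ := mul_le_mul hlow hhigh hp.le measureReal_nonneg

end Steep

end ExpFamily

/-! ### Passage to logarithmic asymptotics -/

namespace ExpFamily

open Set ExpTilt

lemma eventually_mul_log_le (b : ℝ) {d : ℝ} (hd : 0 < d) :
    ∀ᶠ y : ℝ in atTop, b * Real.log y ≤ d * y := by
  have hb : 0 < |b| + 1 := by positivity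
  filter_upwards [Real.isLittleO_log_id_atTop.def (div_pos hd hb), eventually_ge_atTop 1]
    with y hy hy1
  rw [id, Real.norm_eq_abs, Real.norm_eq_abs, abs_of_nonneg (Real.log_nonneg hy1),
    abs_of_nonneg (show 0 ≤ y by linarith), div_mul_eq_mul_div, le_div_iff₀ hb] at hy
  have h1 := Real.log_nonneg hy1
  have h2 := mul_le_mul_of_nonneg_right (le_abs_self b) h1
  linarith

lemma half_le_floor {x : ℝ} (hx : 1 ≤ x) : x / 2 ≤ ⌊x⌋₊ := by
  have h1 : 1 ≤ ⌊x⌋₊ := Nat.le_floor (by exact_mod_cast hx)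
  have h2 : (1 : ℝ) ≤ ⌊x⌋₊ := by exact_mod_cast h1
  linarith [Nat.lt_floor_add_one x]

/-- The exponential term is eventually dominated by the power, and both the factor `1 + C` and the
loss in `⌊x⌋₊ ≥ x / 2` are bounded on the logarithmic scale. -/
lemma eventually_log_div_log_lt {C d b e : ℝ} (hC : 0 ≤ C) (hd : 0 < d) (hb : 0 ≤ b) (he : 0 < e) :
    ∀ᶠ x : ℝ in atTop, ∀ p, 0 < p →
      p ≤ Real.exp (-(⌊x⌋₊ * d)) + C * Real.exp (-(b * Real.log ⌊x⌋₊)) →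
      Real.log p / Real.log x < -b + e := by
  have hfloor : Tendsto (fun x : ℝ => (⌊x⌋₊ : ℝ)) atTop atTop :=
    tendsto_natCast_atTop_atTop.comp tendsto_nat_floor_atTop
  filter_upwards [hfloor.eventually (eventually_mul_log_le b hd), eventually_ge_atTop 2,
    Real.tendsto_log_atTop.eventually
      (eventually_gt_atTop ((Real.log (1 + C) + b * Real.log 2) / e))] with x h1 h2 h3 p hp hle
  have hx0 : 0 < x := by linarith
  have hlogx : 0 < Real.log x := Real.log_pos (by linarith)
  have hhalf := half_le_floor (show 1 ≤ x by linarith)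
  have hlogM : Real.log x - Real.log 2 ≤ Real.log ⌊x⌋₊ := by
    rw [← Real.log_div hx0.ne' (by norm_num)]
    exact Real.log_le_log (by positivity) hhalf
  have h4 : p ≤ (1 + C) * Real.exp (-(b * Real.log ⌊x⌋₊)) := by
    have : Real.exp (-(⌊x⌋₊ * d)) ≤ Real.exp (-(b * Real.log ⌊x⌋₊)) := by
      apply Real.exp_le_exp.2
      linarith
    linarith
  have h5 : Real.log p ≤ Real.log (1 + C) - b * Real.log ⌊x⌋₊ := by
    refine (Real.log_le_log hp h4).trans (le_of_eq ?_)
    rw [Real.log_mul (by positivity) (Real.exp_pos _).ne', Real.log_exp]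
    ring
  rw [div_lt_iff₀ he] at h3
  rw [div_lt_iff₀ hlogx]
  have h6 := mul_le_mul_of_nonneg_left hlogM hb
  linarith

/-- The horizon `⌊x / (1 - γ)⌋₊` exceeds `x` by a positive proportion, which absorbs the logarithmic
loss, while its logarithm differs from that of `x` by a bounded amount. -/
lemma eventually_lt_log_div_log {C D c e γ : ℝ} (hD : 0 < D) (hC : 0 < C) (hc : 0 ≤ c)
    (he : 0 < e) (hγ0 : 0 < γ) (hγ1 : γ < 1) (N : ℕ) :
    ∀ᶠ x : ℝ in atTop, N ≤ ⌊x / (1 - γ)⌋₊ ∧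
      x < ⌊x / (1 - γ)⌋₊ - (D * Real.log ⌊x / (1 - γ)⌋₊ + 1) ∧
      ∀ p, C * Real.exp (-(c * Real.log ⌊x / (1 - γ)⌋₊)) ≤ p →
        -c - e < Real.log p / Real.log x := by
  have h1γ : 0 < 1 - γ := by linarith
  set g := γ / (1 - γ) with hg
  have hg0 : 0 < g := by positivity
  have htend : Tendsto (fun x : ℝ => ⌊x / (1 - γ)⌋₊) atTop atTop :=
    tendsto_nat_floor_atTop.comp (tendsto_id.atTop_div_const h1γ)
  filter_upwards [htend.eventually (eventually_ge_atTop (max N 1)),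
    eventually_mul_log_le D (half_pos hg0),
    eventually_gt_atTop ((2 - D * Real.log (1 - γ)) / (g / 2)), eventually_ge_atTop 2,
    Real.tendsto_log_atTop.eventually
      (eventually_gt_atTop ((-Real.log C - c * Real.log (1 - γ)) / e))] with x h1 h2 h3 h4 h5
  have hx0 : 0 < x := by linarith
  have hlogx : 0 < Real.log x := Real.log_pos (by linarith)
  set t := ⌊x / (1 - γ)⌋₊ with ht
  have ht1 : (1 : ℝ) ≤ t := by exact_mod_cast (le_max_right _ _).trans h1
  have htx : (t : ℝ) ≤ x / (1 - γ) := Nat.floor_le (by positivity)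
  have hxt : x / (1 - γ) - 1 < t := by linarith [Nat.lt_floor_add_one (x / (1 - γ))]
  have hlogt : Real.log t ≤ Real.log x - Real.log (1 - γ) := by
    rw [← Real.log_div hx0.ne' h1γ.ne']
    exact Real.log_le_log (by linarith) htx
  refine ⟨(le_max_left _ _).trans h1, ?_, fun p hp => ?_⟩
  · have e1 : x / (1 - γ) = x + g * x := by rw [hg]; field_simp; ring
    have e2 := mul_le_mul_of_nonneg_left hlogt hD.le
    rw [div_lt_iff₀ (half_pos hg0)] at h3
    linarith
  · have hpos : 0 < C * Real.exp (-(c * Real.log t)) := by positivity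
    have e1 := Real.log_le_log hpos hp
    rw [Real.log_mul hC.ne' (Real.exp_pos _).ne', Real.log_exp] at e1
    rw [div_lt_iff₀ he] at h5
    rw [lt_div_iff₀ hlogx]
    have e2 := mul_le_mul_of_nonneg_left hlogt hc
    linarith

/-- The lower end of the range of `x` is used here: beyond it, log T is negligible against `x`,
uniformly. -/
lemma eventually_log_rpow_le {γ δ x₀ : ℝ} (hγ : 0 < γ) (hδ : 0 < δ) :
    ∀ᶠ T : ℕ in atTop, ∀ x : ℝ, Real.log T ^ (1 + γ) ≤ x →
      x₀ ≤ x ∧ 1 ≤ x ∧ Real.log T / ⌊x⌋₊ < δ := by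
  have hlog : Tendsto (fun T : ℕ => Real.log T) atTop atTop :=
    Real.tendsto_log_atTop.comp tendsto_natCast_atTop_atTop
  have h1 : Tendsto (fun T : ℕ => Real.log T ^ (1 + γ)) atTop atTop :=
    (tendsto_rpow_atTop (by linarith)).comp hlog
  have h2 : Tendsto (fun T : ℕ => Real.log T ^ γ) atTop atTop :=
    (tendsto_rpow_atTop hγ).comp hlog
  filter_upwards [h1.eventually (eventually_ge_atTop (max x₀ 1)),
    h2.eventually (eventually_gt_atTop (2 / δ)), hlog.eventually (eventually_gt_atTop 0)]
    with T e1 e2 e3 x hx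
  have hx1 : 1 ≤ x := (le_max_right _ _).trans (e1.trans hx)
  refine ⟨(le_max_left _ _).trans (e1.trans hx), hx1, ?_⟩
  have hhalf := half_le_floor hx1
  rw [div_lt_iff₀ (by linarith)]
  rw [Real.rpow_add e3, Real.rpow_one] at hx
  rw [div_lt_iff₀ hδ] at e2
  have e4 : Real.log T * 2 < Real.log T * (Real.log T ^ γ * δ) := by gcongr
  have e5 : δ * (Real.log T * Real.log T ^ γ) ≤ δ * x := by gcongr
  have e6 : δ * (x / 2) ≤ δ * ⌊x⌋₊ := by gcongr
  linarith

end ExpFamily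

/-! ### Conclusion -/

theorem theorem2
    (ρ : Measure ℝ) (h : ℝ → ℝ≥0) (hh : Measurable h)
    (hsteep : ExpFamily.IsSteep ρ h)
    (μ₁ μ₂ : ℝ) (hμ₁ : μ₁ ∈ ExpFamily.meanSet ρ h) (hμ₂ : μ₂ ∈ ExpFamily.meanSet ρ h)
    (hμ : μ₂ < μ₁)
    {Ω : Type*} [MeasurableSpace Ω] (P : Measure Ω) [IsProbabilityMeasure P]
    -- `X k i` is the reward of the `(i + 1)`-st play of arm `k`; arm `0` is the optimal one
    (X : Fin 2 → ℕ → Ω → ℝ) (hX : ∀ k i, Measurable (X k i))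
    (hindep : iIndepFun (fun (p : Fin 2 × ℕ) => X p.1 p.2) P)
    (hlaw : ∀ k i, P.map (X k i) = ExpFamily.lawOfMean ρ h (![μ₁, μ₂] k))
    -- `a t` is the arm played by KL-UCB in round `t ≥ 1`
    (a : ℕ → Ω → Fin 2) (ha : ∀ t, Measurable (a t))
    (hrun : ∀ᵐ ω ∂P, ExpFamily.IsKLUCBRun ρ h (fun k i => X k i ω) (fun t => a t ω)) :
    (∀ γ : ℝ, 0 < γ → γ < 1 → ∀ ε : ℝ, 0 < ε → ∃ T₀ : ℕ, ∀ T : ℕ, T₀ ≤ T →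
      ∀ x : ℝ, (Real.log T) ^ (1 + γ) ≤ x → x ≤ (1 - γ) * T →
        0 < P.real {ω | x < (ExpFamily.plays (fun t => a t ω) 1 T : ℝ)} ∧
        |Real.log (P.real {ω | x < (ExpFamily.plays (fun t => a t ω) 1 T : ℝ)}) / Real.log x
          - (- ExpFamily.tailExponent ρ h μ₁ μ₂)| < ε) ∧
    (¬ ExpFamily.LeftTailCondition ρ h → - ExpFamily.tailExponent ρ h μ₁ μ₂ < -1) ∧
    ((∃ L : ℝ, (∀ᵐ y ∂(ExpFamily.lawOfMean ρ h μ₁), L ≤ y) ∧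
        ExpFamily.lawOfMean ρ h μ₁ {L} ≠ 0) → ¬ ExpFamily.LeftTailCondition ρ h) := by
  have hnt : (ExpFamily.meanSet ρ h).Nontrivial := ⟨μ₁, hμ₁, μ₂, hμ₂, hμ.ne'⟩
  have hm := ExpFamily.carrier_ne_zero hh hnt
  obtain ⟨θ₁, hθ₁, rfl⟩ := ExpFamily.exists_mean_eq hh hsteep hnt hμ₁
  obtain ⟨θ₂, hθ₂, rfl⟩ := ExpFamily.exists_mean_eq hh hsteep hnt hμ₂
  have h21 : θ₂ < θ₁ := ((ExpFamily.mean_strictMonoOn hh hsteep hnt).lt_iff_lt hθ₂ hθ₁).1 hμ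
  refine ⟨?_, fun hleft => neg_lt_neg
    (ExpFamily.one_lt_tailExponent hh hsteep hnt hθ₁ hθ₂ h21 hleft),
    fun ⟨L, hL, hatom⟩ => ExpFamily.not_leftTailCondition_of_atom hh hsteep hnt hθ₁ hL hatom⟩
  intro γ hγ0 hγ1 ε hε
  have hlaw0 : ∀ i, P.map (X 0 i) = (ExpFamily.carrier ρ h).tilted (fun x => θ₁ * x) := fun i =>
    (hlaw 0 i).trans (ExpFamily.lawOfMean_mean hh hsteep hnt hθ₁)
  have hlaw1 : ∀ i, P.map (X 1 i) = (ExpFamily.carrier ρ h).tilted (fun x => θ₂ * x) := fun i =>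
    (hlaw 1 i).trans (ExpFamily.lawOfMean_mean hh hsteep hnt hθ₂)
  have hX0 : ExpTilt.IsTiltedSample P (ExpFamily.carrier ρ h) θ₁ (X 0) :=
    ⟨hX 0, hindep.precomp (g := fun i : ℕ => ((0 : Fin 2), i)) (Prod.mk_right_injective 0), hlaw0⟩
  have hX1 : ExpTilt.IsTiltedSample P (ExpFamily.carrier ρ h) θ₂ (X 1) :=
    ⟨hX 1, hindep.precomp (g := fun i : ℕ => ((1 : Fin 2), i)) (Prod.mk_right_injective 1), hlaw1⟩
  have hsupp : ∀ᵐ ω ∂P, ∀ k i, X k i ω ∈ closure (ExpFamily.meanSet ρ h) := by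
    refine ae_all_iff.2 fun k => ae_all_iff.2 fun i => ?_
    have hmem := ExpFamily.ae_mem_closure_meanSet hh hsteep hm hnt.nonempty
    refine ae_of_ae_map (hX k i).aemeasurable ?_
    match k with
    | 0 => exact hlaw0 i ▸ (tilted_absolutelyContinuous _ _).ae_le hmem
    | 1 => exact hlaw1 i ▸ (tilted_absolutelyContinuous _ _).ae_le hmem
  have hκ := ExpFamily.one_le_tailExponent hh hsteep hnt hθ₁ hθ₂ h21
  set κ := ExpFamily.tailExponent ρ h (ExpFamily.mean ρ h θ₁) (ExpFamily.mean ρ h θ₂) with hκdef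
  -- Truncation at 0 keeps the exponent nonnegative, as `eventually_log_div_log_lt` needs, and still
  -- below `κ` because `κ ≥ 1`.
  obtain ⟨C, d, δ, hC, hd, hδ, hupper⟩ := ExpFamily.exists_measure_plays_le hh hsteep hnt hθ₁ hθ₂
    h21 hX0 hX1 hrun hsupp (b := max (κ - ε / 2) 0) (max_lt (by linarith) (by linarith))
  obtain ⟨C', D, N, hC', hD, hlower⟩ := ExpFamily.exists_le_measure_plays hh hsteep hnt hθ₁ hθ₂
    hX0 hX1 hindep hrun hsupp (c := κ + ε / 2) (by linarith)
  obtain ⟨x₀, hx₀⟩ := eventually_atTop.1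
    ((ExpFamily.eventually_log_div_log_lt hC hd (le_max_right (κ - ε / 2) 0) (half_pos hε)).and
      (ExpFamily.eventually_lt_log_div_log hD hC' (show 0 ≤ κ + ε / 2 by linarith) (half_pos hε)
        hγ0 hγ1 N))
  obtain ⟨T₀, hT₀⟩ := eventually_atTop.1
    (ExpFamily.eventually_log_rpow_le (x₀ := x₀) hγ0 hδ)
  refine ⟨T₀, fun T hT x hx1 hx2 => ?_⟩
  obtain ⟨hxx₀, hx1', hlogT⟩ := hT₀ T hT x hx1
  obtain ⟨hup, hN, hlt, hlow⟩ := hx₀ x hxx₀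
  set t := ⌊x / (1 - γ)⌋₊ with ht
  -- The upper end of the range of `x` is exactly what places the shorter horizon `t` within `T`;
  -- the number of plays only grows from `t` to `T`.
  have htT : t ≤ T := by
    refine Nat.floor_le_of_le ?_
    rw [div_le_iff₀ (by linarith)]
    linarith
  have hlowp := (hlower t hN).trans (measureReal_mono (μ := P)
    (show {ω | (t : ℝ) - (D * Real.log t + 1) ≤ ExpFamily.plays (fun t => a t ω) 1 t} ⊆
        {ω | x < (ExpFamily.plays (fun t => a t ω) 1 T : ℝ)} from fun ω hω => by
      have h1 : (ExpFamily.plays (fun t => a t ω) 1 t : ℝ)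
          ≤ ExpFamily.plays (fun t => a t ω) 1 T := by
        exact_mod_cast ExpFamily.plays_mono (fun t => a t ω) 1 htT
      exact hlt.trans_le (le_trans hω h1)))
  have hpos : 0 < P.real {ω | x < (ExpFamily.plays (fun t => a t ω) 1 T : ℝ)} :=
    lt_of_lt_of_le (by positivity) hlowp
  have hfloor : {ω | x < (ExpFamily.plays (fun t => a t ω) 1 T : ℝ)}
      = {ω | ⌊x⌋₊ < ExpFamily.plays (fun t => a t ω) 1 T} := by
    ext ω
    exact (Nat.floor_lt (zero_le_one.trans hx1')).symm
  have hupp := hupper ⌊x⌋₊ T (Nat.le_floor (by exact_mod_cast hx1')) hlogT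
  rw [← hfloor] at hupp
  refine ⟨hpos, abs_lt.2 ⟨?_, ?_⟩⟩
  · linarith [hlow _ hlowp]
  · linarith [hup _ hpos hupp, le_max_left (κ - ε / 2) 0]
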